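/- **Theorem (Stability of Scheme-I).** *Setting.* Let $d\in\{2,3\}$, let $\Omega\subset\mathbb R^d$ be a bounded domain and let $\Omega_h$ be a conforming triangulation of $\Omega$ into finitely many $d$-simplices $K$ with $\overline\Omega=\bigcup K$ and $\operatorname{int}K\subset\Omega$; let $h=\max_K\operatorname{diam}K$. Let $\mathcal E$ be the set of $(d-1)$-faces, $\mathcal E^E$ those contained in $\partial\Omega$, $\mathcal E^I=\mathcal E\setminus\mathcal E^E$, and fix a unit normal $\mathbf n_\sigma$ of each face $\sigma$, pointing outwards on $\mathcal E^E$. For $\sigma\in\mathcal E^I$, $f^{\rm in}$ and $f^{\rm out}$ are the traces of $f$ from the element out of which, respectively into which, $\mathbf n_\sigma$ points; $[\![f]\!]=f^{\rm out}-f^{\rm in}$, $\{\!\{f\}\!\}=\frac12(f^{\rm out}+f^{\rm in})$. Operators $\nabla_h,\operatorname{div}_h,\operatorname{Curl}_h$ act elementwise; for $d=2$ cross products and curls are those of the fields extended by a zero third component and independent of $x_3$. For a field $\mathbf v$, $\widehat{\mathbf v}$ is the piecewise constant function with value $\frac1{|K|}\int_K\mathbf v$ on $K$. *Spaces.* $Q_h$: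 piecewise constant scalar functions. $V_h$: piecewise affine $\mathbb R^d$-valued fields with $\int_\sigma[\![\mathbf v]\!]=0$ for $\sigma\in\mathcal E^I$; $V_{0,h}$: those with moreover $\int_\sigma\mathbf v=0$ for $\sigma\in\mathcal E^E$. $N_h$: fields with $\mathbf v,\operatorname{Curl}\mathbf v\in L^2(\Omega)$ of the form $\mathbf a_K+S_K x$ on each $K$ with $\mathbf a_K\in\mathbb R^d$ and $S_K$ a skew-symmetric $d\times d$ matrix, and $\int_\sigma[\![\mathbf v\times\mathbf n]\!]=0$ for $\sigma\in\mathcal E^I$ (lowest order Nédélec elements); $N_{0,h}$: those with moreover $\int_\sigma\mathbf v\times\mathbf n=0$ for $\sigma\in\mathcal E^E$. *Scheme.* Let $\mu>0$, $\lambda\ge0$, $\nu=\frac{d-2}{d}\mu+\lambda$, $\alpha>0$, $a>0$, $\gamma>1$, $p(\varrho)=a\varrho^\gamma$, $\mathcal H(\varrho)=\frac{a}{\gamma-1}\varrho^\gamma$, $\varepsilon>0$, $\Delta t>0$, $N\in\mathbb N$. For a sequence $(v^k)$ write $v^\triangleleft=v^{k-1}$ and $D_tv=(v^k-v^{k-1})/\Delta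 t$ at step $k$. Let $u_\sigma=\frac1{|\sigma|}\int_\sigma\mathbf u_h\cdot\mathbf n_\sigma$, $[s]^\pm=\frac{s\pm|s|}2$, $r^{\rm up}=r^{\rm in}$ if $u_\sigma\ge0$ and $r^{\rm up}=r^{\rm out}$ otherwise, and $F_h^\varepsilon(r,\mathbf u_h)=r^{\rm in}[u_\sigma]^++r^{\rm out}[u_\sigma]^--h^\varepsilon[\![r]\!]$. Let $\varrho_0\in L^1(\Omega)$, $\varrho_0>0$ a.e. A solution of Scheme-I is a sequence $(\varrho_h^k,\mathbf u_h^k,\mathbf B_h^k)_{0\le k\le N}$ such that $\varrho_h^0|_K=\frac1{|K|}\int_K\varrho_0$, $\mathbf u_h^0\in V_h$, $\mathbf B_h^0\in N_h$ (for instance interpolants of the initial velocity and magnetic field) and, for each $k=1,\dots,N$, $(\varrho_h,\mathbf u_h,\mathbf B_h)=(\varrho_h^k,\mathbf u_h^k,\mathbf B_h^k)\in Q_h\times V_{0,h}\times N_{0,h}$ satisfies $$\int_\Omega D_t\varrho_h\,\phi_h-\sum_{\sigma\in\mathcal E^I}\int_\sigma F_h^\varepsilon(\varrho_h,\mathbf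 u_h)[\![\phi_h]\!]=0\quad\forall\phi_h\in Q_h,$$ $$\int_\Omega D_t(\varrho_h\widehat{\mathbf u_h})\cdot\mathbf v_h-\sum_{\sigma\in\mathcal E^I}\int_\sigma F_h^\varepsilon(\varrho_h\widehat{\mathbf u_h},\mathbf u_h)\cdot[\![\widehat{\mathbf v_h}]\!]+\mu\int_\Omega\nabla_h\mathbf u_h:\nabla_h\mathbf v_h+\int_\Omega(\nu\operatorname{div}_h\mathbf u_h-p(\varrho_h))\operatorname{div}_h\mathbf v_h-\int_\Omega(\operatorname{Curl}_h\mathbf B_h\times\mathbf B_h^\triangleleft)\cdot\mathbf v_h=0\quad\forall\mathbf v_h\in V_{0,h},$$ $$\int_\Omega\big(D_t\mathbf B_h\cdot\mathbf C_h+\alpha\operatorname{Curl}_h\mathbf B_h\cdot\operatorname{Curl}_h\mathbf C_h-(\mathbf u_h\times\mathbf B_h^\triangleleft)\cdot\operatorname{Curl}_h\mathbf C_h\big)=0\quad\forall\mathbf C_h\in N_{0,h}.$$ *Claim.* For every solution and every step $k=1,\dots,N$ there are a piecewise constant $\xi$ with $\xi|_K$ between $\varrho_h^\triangleleft|_K$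 and $\varrho_h|_K$ for every element $K$, and numbers $\zeta_\sigma$ between $\varrho_h^{\rm in}$ and $\varrho_h^{\rm out}$ for every $\sigma\in\mathcal E^I$, such that $$D_t\int_\Omega\Big(\tfrac12\varrho_h|\widehat{\mathbf u_h}|^2+\mathcal H(\varrho_h)+\tfrac12|\mathbf B_h|^2\Big)+\mu\|\nabla_h\mathbf u_h\|_{L^2}^2+\nu\|\operatorname{div}_h\mathbf u_h\|_{L^2}^2+\alpha\|\operatorname{Curl}_h\mathbf B_h\|_{L^2}^2$$ $$=-\tfrac{\Delta t}2\int_\Omega\varrho_h^\triangleleft|D_t\widehat{\mathbf u_h}|^2-\tfrac{\Delta t}2\int_\Omega|D_t\mathbf B_h|^2-\tfrac{\Delta t}2\int_\Omega\mathcal H''(\xi)|D_t\varrho_h|^2$$ $$-\sum_{\sigma\in\mathcal E^I}\int_\sigma\Big(\varrho_h^{\rm up}\tfrac{|u_\sigma|}2+h^\varepsilon\{\!\{\varrho_h\}\!\}\Big)\big|[\![\widehat{\mathbf u_h}]\!]\big|^2-\sum_{\sigma\in\mathcal E^I}\int_\sigma\mathcal H''(\zeta_\sigma)[\![\varrho_h]\!]^2\Big(h^\varepsilon+\tfrac{|u_\sigma|}2\Big)\le0.$$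 Each of the five terms on the right-hand side is nonpositive; in particular the total energy $\int_\Omega(\frac12\varrho_h|\widehat{\mathbf u_h}|^2+\mathcal H(\varrho_h)+\frac12|\mathbf B_h|^2)$ does not increase from one time step to the next. -/

import Mathlib

open MeasureTheory
open scoped Matrix ContDiff

noncomputable section

namespace MHD

/-- Points and vectors of `ℝ^d`, with the Euclidean norm. -/
abbrev Pt (d : ℕ) := EuclideanSpace ℝ (Fin d)

/-! ### Meshes -/

/-- A conforming triangulation of `Ω ⊆ ℝ^d` by finitely many `d`-simplices. An element is recorded
by the set of its `d + 1` vertices, the element itself being the convex hull of that set. -/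
structure Triangulation (d : ℕ) (Ω : Set (Pt d)) where
  cells : Finset (Finset (Pt d))
  card_eq : ∀ K ∈ cells, K.card = d + 1
  indep : ∀ K ∈ cells, AffineIndependent ℝ ((↑) : K → Pt d)
  /-- Two elements meet along a common (possibly empty) subsimplex. -/
  conforming : ∀ K ∈ cells, ∀ L ∈ cells,
    convexHull ℝ (K : Set (Pt d)) ∩ convexHull ℝ (L : Set (Pt d))
      ⊆ convexHull ℝ ((K : Set (Pt d)) ∩ (L : Set (Pt d)))
  closure_eq : closure Ω = ⋃ K ∈ cells, convexHull ℝ (K : Set (Pt d))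
  interior_subset : ∀ K ∈ cells, interior (convexHull ℝ (K : Set (Pt d))) ⊆ Ω

variable {d : ℕ} {Ω : Set (Pt d)}

namespace Triangulation

/-- The elements of the triangulation. -/
abbrev Cell (T : Triangulation d Ω) := {K : Finset (Pt d) // K ∈ T.cells}

open Classical in
/-- The vertex sets of all `(d-1)`-dimensional faces of elements. -/
def faces (T : Triangulation d Ω) : Finset (Finset (Pt d)) :=
  T.cells.biUnion fun K => K.powersetCard d

/-- The `(d-1)`-dimensional faces of the triangulation. -/
abbrev Face (T : Triangulation d Ω) := {σ : Finset (Pt d) // σ ∈ T.faces}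

/-- The closed simplex occupied by an element. -/
def body (T : Triangulation d Ω) (K : T.Cell) : Set (Pt d) := convexHull ℝ (K.1 : Set (Pt d))

/-- The closed `(d-1)`-simplex occupied by a face. -/
def faceBody (T : Triangulation d Ω) (σ : T.Face) : Set (Pt d) := convexHull ℝ (σ.1 : Set (Pt d))

open Classical in
/-- Exterior faces: those contained in the boundary of `Ω`. -/
def extFaces (T : Triangulation d Ω) : Finset T.Face :=
  Finset.univ.filter fun σ => T.faceBody σ ⊆ frontier Ω

open Classical in
/-- Interior faces: all the others. -/
def intFaces (T : Triangulation d Ω) : Finset T.Face :=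
  Finset.univ.filter fun σ => ¬ T.faceBody σ ⊆ frontier Ω

/-- The mesh size: the maximal diameter of the elements. -/
def size (T : Triangulation d Ω) : ℝ := ⨆ K : T.Cell, Metric.diam (T.body K)

/-- Integral over `Ω` of a function given separately on each element. -/
def integral (T : Triangulation d Ω) (f : T.Cell → Pt d → ℝ) : ℝ :=
  ∑ K : T.Cell, ∫ x in T.body K, f K x

/-- Surface integral over a face (`(d-1)`-dimensional Hausdorff measure, normalised to agree with
the usual surface measure). -/
def faceIntegral {V : Type*} [NormedAddCommGroup V] [NormedSpace ℝ V]
    (T : Triangulation d Ω) (σ : T.Face) (f : Pt d → V) : V :=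
  ∫ x in T.faceBody σ, f x ∂(μHE[d - 1] : Measure (Pt d))

/-- The surface measure `|σ|` of a face. -/
def faceArea (T : Triangulation d Ω) (σ : T.Face) : ℝ :=
  (μHE[d - 1] : Measure (Pt d)).real (T.faceBody σ)

/-- A choice, for every face `σ`, of a unit normal `n_σ`, together with the element `inn σ`
out of which `n_σ` points and, for interior faces, the element `out σ` into which it points
(the value of `out` at an exterior face is irrelevant). Thus `f^in` and `f^out` on `σ` are the
traces taken from `inn σ` and `out σ`. -/
structure Orientation (T : Triangulation d Ω) where
  normal : T.Face → Pt d
  inn : T.Face → T.Cell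
  out : T.Face → T.Cell
  norm_normal : ∀ σ, ‖normal σ‖ = 1
  normal_orthogonal : ∀ σ, ∀ x ∈ σ.1, ∀ y ∈ σ.1, inner ℝ (normal σ) (x - y) = 0
  subset_inn : ∀ σ, σ.1 ⊆ (inn σ).1
  inner_inn : ∀ σ, ∀ y ∈ σ.1, ∀ z ∈ (inn σ).1, z ∉ σ.1 → inner ℝ (normal σ) (z - y) < 0
  subset_out : ∀ σ ∈ T.intFaces, σ.1 ⊆ (out σ).1
  inner_out : ∀ σ ∈ T.intFaces, ∀ y ∈ σ.1, ∀ z ∈ (out σ).1, z ∉ σ.1 →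
    0 < inner ℝ (normal σ) (z - y)

/-- Piecewise constant functions `Q_h`: one value per element. -/
abbrev PwConst (T : Triangulation d Ω) := T.Cell → ℝ

/-- Piecewise (discontinuous) affine vector fields: one affine vector field per element. -/
abbrev PwAffine (T : Triangulation d Ω) := T.Cell → (Pt d →ᵃ[ℝ] Pt d)

end Triangulation

/-! ### Vector calculus in dimensions two and three -/

/-- The inclusion `ℝ^d → ℝ^3` for `d ≤ 3` (for `d = 2` the third component is zero); cross products
and curls of planar vectors are those of the corresponding vectors of `ℝ^3`. -/
def toR3 (v : Pt d) : Fin 3 → ℝ := fun i => if h : i.1 < d then v ⟨i.1, h⟩ else 0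

/-- The `j`-th coordinate direction of `ℝ^3` as a direction of `ℝ^d`; for `d = 2` it is zero
for the third direction: nothing depends on the third variable. -/
def dir (d : ℕ) (j : Fin 3) : Pt d :=
  if h : j.1 < d then EuclideanSpace.single ⟨j.1, h⟩ (1 : ℝ) else 0

/-- The curl of a field with values in `ℝ^3` whose differential at the point is `A`:
`(Curl F)_i = ∂_{i+1} F_{i+2} - ∂_{i+2} F_{i+1}`, indices modulo three. -/
def curlOf (A : Pt d → Fin 3 → ℝ) : Fin 3 → ℝ :=
  fun i => A (dir d (i + 1)) (i + 2) - A (dir d (i + 2)) (i + 1)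

/-- The partial derivative `∂_j v_i` of an affine vector field. -/
def partialDeriv (v : Pt d →ᵃ[ℝ] Pt d) (i j : Fin d) : ℝ :=
  v.linear (EuclideanSpace.single j (1 : ℝ)) i

/-- `∇v : ∇w` for affine vector fields. -/
def gradInner (v w : Pt d →ᵃ[ℝ] Pt d) : ℝ := ∑ i, ∑ j, partialDeriv v i j * partialDeriv w i j

/-- The divergence of an affine vector field. -/
def divg (v : Pt d →ᵃ[ℝ] Pt d) : ℝ := ∑ i, partialDeriv v i i

/-- The curl of an affine vector field. -/
def curl (v : Pt d →ᵃ[ℝ] Pt d) : Fin 3 → ℝ := curlOf fun e => toR3 (v.linear e)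

/-! ### Discrete spaces -/

namespace Triangulation

variable (T : Triangulation d Ω)

/-- The Crouzeix--Raviart space `V_h`. -/
def crouzeixRaviart (O : T.Orientation) : Set T.PwAffine :=
  {v | ∀ σ ∈ T.intFaces, T.faceIntegral σ (fun x => v (O.out σ) x - v (O.inn σ) x) = 0}

/-- The subspace of `V_h` of fields with zero mean on the exterior faces. -/
def crouzeixRaviart₀ (O : T.Orientation) : Set T.PwAffine :=
  {v | v ∈ T.crouzeixRaviart O ∧
    ∀ σ ∈ T.extFaces, ∀ K : T.Cell, σ.1 ⊆ K.1 → T.faceIntegral σ (fun x => v K x) = 0}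

/-- `Curl v ∈ L^2(Ω)` in the sense of distributions. -/
def HasL2Curl (v : T.PwAffine) : Prop :=
  ∃ g : Pt d → Fin 3 → ℝ, MemLp g 2 (volume.restrict Ω) ∧
    ∀ φ : Pt d → Fin 3 → ℝ, ContDiff ℝ ∞ φ → HasCompactSupport φ → tsupport φ ⊆ Ω →
      T.integral (fun K x => toR3 (v K x) ⬝ᵥ curlOf (fderiv ℝ φ x)) = ∫ x in Ω, g x ⬝ᵥ φ x

/-- The lowest order Nédélec edge element space `N_h`: on every element the field is `a + S x` with
a constant vector `a` and a skew-symmetric matrix `S` (that is, `a + b × x` if `d = 3` and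
`a + b x^⊥` if `d = 2`). -/
def nedelec (O : T.Orientation) : Set T.PwAffine :=
  {v | (∀ K x, inner ℝ ((v K).linear x) x = 0) ∧ T.HasL2Curl v ∧
    ∀ σ ∈ T.intFaces, T.faceIntegral σ
      (fun x => crossProduct (toR3 (v (O.out σ) x - v (O.inn σ) x)) (toR3 (O.normal σ))) = 0}

/-- The subspace of `N_h` of fields whose tangential part has zero mean on the exterior faces. -/
def nedelec₀ (O : T.Orientation) : Set T.PwAffine :=
  {v | v ∈ T.nedelec O ∧ ∀ σ ∈ T.extFaces, ∀ K : T.Cell, σ.1 ⊆ K.1 →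
    T.faceIntegral σ (fun x => crossProduct (toR3 (v K x)) (toR3 (O.normal σ))) = 0}

/-! ### Discrete operators -/

/-- The projection onto piecewise constants: the mean value of a field on each element. -/
def cellMean (v : T.PwAffine) : T.Cell → Pt d := fun K => ⨍ x in T.body K, v K x

/-- The jump `f^out - f^in` of a piecewise constant function across a face. -/
def jump {T : Triangulation d Ω} {V : Type*} [AddCommGroup V] (O : T.Orientation)
    (f : T.Cell → V) (σ : T.Face) : V := f (O.out σ) - f (O.inn σ)

/-- The average of a piecewise constant function at a face. -/
def avg {T : Triangulation d Ω} (O : T.Orientation) (f : T.PwConst) (σ : T.Face) : ℝ :=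
  (f (O.out σ) + f (O.inn σ)) / 2

/-- The mean normal velocity `u_σ` through a face. -/
def faceVel (O : T.Orientation) (u : T.PwAffine) (σ : T.Face) : ℝ :=
  (1 / T.faceArea σ) * inner ℝ (T.faceIntegral σ fun x => u (O.inn σ) x) (O.normal σ)

/-- The upwind value `r^up` at a face. -/
def upwind (O : T.Orientation) (r : T.PwConst) (u : T.PwAffine) (σ : T.Face) : ℝ :=
  if 0 ≤ T.faceVel O u σ then r (O.inn σ) else r (O.out σ)

/-- The diffusive upwind flux `r^in [u_σ]^+ + r^out [u_σ]^- - h^ε (r^out - r^in)`. -/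
def flux {V : Type*} [AddCommGroup V] [Module ℝ V] (O : T.Orientation) (ε : ℝ)
    (r : T.Cell → V) (u : T.PwAffine) (σ : T.Face) : V :=
  ((T.faceVel O u σ + |T.faceVel O u σ|) / 2) • r (O.inn σ)
    + ((T.faceVel O u σ - |T.faceVel O u σ|) / 2) • r (O.out σ)
    - (T.size ^ ε) • jump O r σ

end Triangulation

/-! ### The scheme -/

/-- Physical and numerical parameters: viscosities `μ > 0`, `λ ≥ 0`, resistivity `α > 0`, pressure
law `p(ϱ) = a ϱ^γ` with `a > 0`, `γ > 1`, artificial diffusion exponent `ε > 0` and time step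
`Δt > 0`. -/
structure Params where
  mu : ℝ
  lam : ℝ
  alpha : ℝ
  a : ℝ
  gamma : ℝ
  eps : ℝ
  dt : ℝ
  mu_pos : 0 < mu
  lam_nonneg : 0 ≤ lam
  alpha_pos : 0 < alpha
  a_pos : 0 < a
  one_lt_gamma : 1 < gamma
  eps_pos : 0 < eps
  dt_pos : 0 < dt

namespace Params

/-- `ν = (d-2)/d μ + λ`. -/
def nu (P : Params) (d : ℕ) : ℝ := ((d : ℝ) - 2) / d * P.mu + P.lam

/-- The pressure `p(r) = a r^γ`. -/
def pressure (P : Params) (r : ℝ) : ℝ := P.a * r ^ P.gamma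

/-- The pressure potential `H(r) = a/(γ-1) r^γ`. -/
def potential (P : Params) (r : ℝ) : ℝ := P.a / (P.gamma - 1) * r ^ P.gamma

/-- The second derivative `H''`. -/
def potential'' (P : Params) (r : ℝ) : ℝ := iteratedDeriv 2 P.potential r

/-- The backward Euler difference quotient `(new - old) / Δt`. -/
def Dt {V : Type*} [AddCommGroup V] [Module ℝ V] (P : Params) (old new : V) : V :=
  P.dt⁻¹ • (new - old)

end Params

namespace Triangulation

variable (T : Triangulation d Ω)

/-- The discrete continuity equation for the step from the density `ρ'` to `(ρ, u)`. -/
def ContinuityEq (O : T.Orientation) (P : Params) (ρ' ρ : T.PwConst) (u : T.PwAffine) : Prop :=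
  ∀ φ : T.PwConst,
    T.integral (fun K _ => P.Dt (ρ' K) (ρ K) * φ K)
      - ∑ σ ∈ T.intFaces, T.faceIntegral σ (fun _ => T.flux O P.eps ρ u σ * jump O φ σ) = 0

/-- The discrete momentum equation for the step from `(ρ', u', B')` to `(ρ, u, B)`. -/
def MomentumEq (O : T.Orientation) (P : Params) (ρ' ρ : T.PwConst) (u' u B' B : T.PwAffine) :
    Prop :=
  ∀ v ∈ T.crouzeixRaviart₀ O,
    T.integral (fun K x =>
        inner ℝ (P.Dt (ρ' K • T.cellMean u' K) (ρ K • T.cellMean u K)) (v K x))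
      - ∑ σ ∈ T.intFaces, T.faceIntegral σ (fun _ =>
          inner ℝ (T.flux O P.eps (fun K => ρ K • T.cellMean u K) u σ) (jump O (T.cellMean v) σ))
      + P.mu * T.integral (fun K _ => gradInner (u K) (v K))
      + T.integral (fun K _ => (P.nu d * divg (u K) - P.pressure (ρ K)) * divg (v K))
      - T.integral (fun K x => crossProduct (curl (B K)) (toR3 (B' K x)) ⬝ᵥ toR3 (v K x)) = 0

/-- The discrete Maxwell equation for the step from `B'` to `(u, B)`. -/
def MaxwellEq (O : T.Orientation) (P : Params) (u B' B : T.PwAffine) : Prop :=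
  ∀ C ∈ T.nedelec₀ O,
    T.integral (fun K x => inner ℝ (P.Dt (B' K x) (B K x)) (C K x)
      + P.alpha * (curl (B K) ⬝ᵥ curl (C K))
      - crossProduct (toR3 (u K x)) (toR3 (B' K x)) ⬝ᵥ curl (C K)) = 0

/-- `(ρ^k, u^k, B^k)`, `k = 0, …, N`, is a solution of the scheme on `N` time steps with initial
density `ρ₀`. The discrete initial velocity and magnetic field may be any members of `V_h` and `N_h`,
so that every choice of interpolants of the initial data is covered. -/
structure IsSolution (O : T.Orientation) (P : Params) (N : ℕ) (ρ₀ : Pt d → ℝ)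
    (ρ : ℕ → T.PwConst) (u B : ℕ → T.PwAffine) : Prop where
  init_density : ∀ K, ρ 0 K = ⨍ x in T.body K, ρ₀ x
  init_velocity : u 0 ∈ T.crouzeixRaviart O
  init_magnetic : B 0 ∈ T.nedelec O
  velocity_mem : ∀ k < N, u (k + 1) ∈ T.crouzeixRaviart₀ O
  magnetic_mem : ∀ k < N, B (k + 1) ∈ T.nedelec₀ O
  continuity : ∀ k < N, T.ContinuityEq O P (ρ k) (ρ (k + 1)) (u (k + 1))
  momentum : ∀ k < N, T.MomentumEq O P (ρ k) (ρ (k + 1)) (u k) (u (k + 1)) (B k) (B (k + 1))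
  maxwell : ∀ k < N, T.MaxwellEq O P (u (k + 1)) (B k) (B (k + 1))

/-! ### Energy and dissipation -/

/-- The total energy: kinetic, internal and magnetic. -/
def energy (P : Params) (ρ : T.PwConst) (u B : T.PwAffine) : ℝ :=
  T.integral fun K x =>
    1 / 2 * ρ K * ‖T.cellMean u K‖ ^ 2 + P.potential (ρ K) + 1 / 2 * ‖B K x‖ ^ 2

/-- `μ ‖∇_h u‖² + ν ‖div_h u‖² + α ‖Curl_h B‖²`, with `L^2(Ω)` norms. -/
def physicalDissipation (P : Params) (u B : T.PwAffine) : ℝ :=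
  P.mu * T.integral (fun K _ => gradInner (u K) (u K))
    + P.nu d * T.integral (fun K _ => divg (u K) ^ 2)
    + P.alpha * T.integral (fun K _ => curl (B K) ⬝ᵥ curl (B K))

/-- Time-step dissipation of the velocity. -/
def timeDissVelocity (P : Params) (ρ' : T.PwConst) (u' u : T.PwAffine) : ℝ :=
  P.dt / 2 * T.integral fun K _ => ρ' K * ‖P.Dt (T.cellMean u' K) (T.cellMean u K)‖ ^ 2

/-- Time-step dissipation of the magnetic field. -/
def timeDissMagnetic (P : Params) (B' B : T.PwAffine) : ℝ :=
  P.dt / 2 * T.integral fun K x => ‖P.Dt (B' K x) (B K x)‖ ^ 2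

/-- Time-step dissipation of the density. -/
def timeDissDensity (P : Params) (ξ ρ' ρ : T.PwConst) : ℝ :=
  P.dt / 2 * T.integral fun K _ => P.potential'' (ξ K) * |P.Dt (ρ' K) (ρ K)| ^ 2

/-- Upwind and jump dissipation of the velocity. -/
def jumpDissVelocity (O : T.Orientation) (P : Params) (ρ : T.PwConst) (u : T.PwAffine) : ℝ :=
  ∑ σ ∈ T.intFaces, T.faceIntegral σ fun _ =>
    (T.upwind O ρ u σ * (|T.faceVel O u σ| / 2) + T.size ^ P.eps * avg O ρ σ)
      * ‖jump O (T.cellMean u) σ‖ ^ 2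

/-- Upwind and jump dissipation of the density. -/
def jumpDissDensity (O : T.Orientation) (P : Params) (ζ : T.Face → ℝ) (ρ : T.PwConst)
    (u : T.PwAffine) : ℝ :=
  ∑ σ ∈ T.intFaces, T.faceIntegral σ fun _ =>
    P.potential'' (ζ σ) * jump O ρ σ ^ 2 * (T.size ^ P.eps + |T.faceVel O u σ| / 2)

end Triangulation

end MHD

end

namespace MHD

open Module

/-! ### Affine maps on simplices -/

section AffineBasis

variable {ι V E : Type*}
  [NormedAddCommGroup V] [InnerProductSpace ℝ V]
  [NormedAddCommGroup E] [NormedSpace ℝ E]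

/-! The energy balance is the sum of three balances obtained by testing the scheme with its own
solution. The momentum equation is tested with `u`, and the continuity equation tested with half the
squared cell mean of `u` is subtracted (`kinetic_balance`); the continuity equation is tested with
the first derivative of the potential (`internal_balance`); the Maxwell equation is tested with `B`
(`magnetic_balance`). The pressure work cancels between the first two, the work of the Lorentz force
between the first and the third. What remains are the squares left over by implicit time stepping,
upwinding and artificial diffusion.

On each cell and face these remainders come from pointwise identities: polarisation for the
quadratic energies (`kinetic_time_identity`, `kinetic_flux_identity`, `magnetic_time_identity`),
Taylor expansion of the convex potential for the internal energy (`internal_time_identity`,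
`internal_flux_identity`). The latter yield the intermediate values ξ and ζ and need a positive
density, which `density_pos` propagates from the initial datum.

The geometric input is `sum_volume_mul_divg`, needed because pressure meets an elementwise
divergence in one equation and face fluxes in the other. It rests on the divergence theorem for
affine fields on a simplex, derived here from vertex averages and the volume of a cone
(`divergence_simplex`), and on the fact that an interior face borders exactly two elements, which
conformity provides (`cell_eq_of_same_side`). -/

lemma affineMap_eq_sum_coord [Fintype ι] (b : AffineBasis ι ℝ V) (f : V →ᵃ[ℝ] E) (q : V) :
    f q = ∑ i, b.coord i q • f (b i) := by
  conv_lhs => rw [← b.affineCombination_coord_eq_self q]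
  rw [Finset.map_affineCombination _ _ _ (b.sum_coord_apply_eq_one q),
    Finset.affineCombination_eq_linear_combination _ _ _ (b.sum_coord_apply_eq_one q)]
  rfl

lemma affineMap_linear_eq_sum_coord [Fintype ι] (b : AffineBasis ι ℝ V) (f : V →ᵃ[ℝ] E) (w : V) :
    f.linear w = ∑ i, (b.coord i).linear w • f (b i) := by
  have h1 : f.linear w = f w - f 0 := by
    simpa using f.linearMap_vsub w 0
  have h2 : ∀ i, (b.coord i).linear w = b.coord i w - b.coord i 0 := fun i => by
    simpa using (b.coord i).linearMap_vsub w 0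
  rw [h1, affineMap_eq_sum_coord b f w, affineMap_eq_sum_coord b f 0, ← Finset.sum_sub_distrib]
  simp only [h2, sub_smul]

/-- The barycentric coordinates add up to the constant one, so their differentials cancel. In the
divergence theorem this removes the contribution common to all faces. -/
lemma sum_coord_linear_eq_zero [Fintype ι] (b : AffineBasis ι ℝ V) (w : V) :
    ∑ i, (b.coord i).linear w = 0 := by
  have h := affineMap_linear_eq_sum_coord b (AffineMap.const ℝ V (1 : ℝ)) w
  simpa using h.symm

/-- The affine reflection exchanging two vertices of a simplex. -/
noncomputable def vertexSwap (b : AffineBasis ι ℝ V) (i j : ι) : V →ᵃ[ℝ] V :=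
  AffineMap.id ℝ V + ((LinearMap.toSpanSingleton ℝ V (b j - b i)).toAffineMap.comp
    (b.coord i - b.coord j))

lemma vertexSwap_apply (b : AffineBasis ι ℝ V) (i j : ι) (x : V) :
    vertexSwap b i j x = x + (b.coord i x - b.coord j x) • (b j - b i) := by
  simp [vertexSwap, sub_smul]

lemma coord_vertexSwap (b : AffineBasis ι ℝ V) (i j k : ι) (x : V) :
    b.coord k (vertexSwap b i j x) =
      b.coord k x + (b.coord i x - b.coord j x) * (b.coord k (b j) - b.coord k (b i)) := by
  have h : (b.coord k).linear (b j - b i) = b.coord k (b j) - b.coord k (b i) := by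
    simpa using (b.coord k).linearMap_vsub (b j) (b i)
  rw [vertexSwap_apply, add_comm x, ← vadd_eq_add, AffineMap.map_vadd, map_smul, h]
  simp [add_comm]

lemma coord_vertexSwap_left (b : AffineBasis ι ℝ V) {i j : ι} (hij : i ≠ j) (x : V) :
    b.coord i (vertexSwap b i j x) = b.coord j x := by
  rw [coord_vertexSwap, b.coord_apply_ne hij, b.coord_apply_eq]; ring

lemma coord_vertexSwap_right (b : AffineBasis ι ℝ V) {i j : ι} (hij : i ≠ j) (x : V) :
    b.coord j (vertexSwap b i j x) = b.coord i x := by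
  rw [coord_vertexSwap, b.coord_apply_ne hij.symm, b.coord_apply_eq]; ring

lemma coord_vertexSwap_other (b : AffineBasis ι ℝ V) {i j k : ι} (hi : k ≠ i) (hj : k ≠ j)
    (x : V) : b.coord k (vertexSwap b i j x) = b.coord k x := by
  rw [coord_vertexSwap, b.coord_apply_ne hi, b.coord_apply_ne hj]; ring

lemma vertexSwap_vertexSwap (b : AffineBasis ι ℝ V) {i j : ι} (hij : i ≠ j) (x : V) :
    vertexSwap b i j (vertexSwap b i j x) = x := by
  rw [vertexSwap_apply, coord_vertexSwap_left b hij, coord_vertexSwap_right b hij,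
    vertexSwap_apply]
  module

/-- The simplex is the set where all barycentric coordinates are nonnegative, and the reflection
only permutes these coordinates. -/
lemma vertexSwap_preimage_convexHull (b : AffineBasis ι ℝ V) {i j : ι} (hij : i ≠ j) :
    vertexSwap b i j ⁻¹' convexHull ℝ (Set.range b) = convexHull ℝ (Set.range b) := by
  ext x
  simp only [b.convexHull_eq_nonneg_coord, Set.mem_preimage, Set.mem_ofPred_eq]
  constructor
  · intro h k
    by_cases hi : k = i
    · subst hi; rw [← coord_vertexSwap_right b hij]; exact h j
    by_cases hj : k = j
    · subst hj; rw [← coord_vertexSwap_left b hij]; exact h i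
    · rw [← coord_vertexSwap_other b hi hj]; exact h k
  · intro h k
    by_cases hi : k = i
    · subst hi; rw [coord_vertexSwap_left b hij]; exact h j
    by_cases hj : k = j
    · subst hj; rw [coord_vertexSwap_right b hij]; exact h i
    · rw [coord_vertexSwap_other b hi hj]; exact h k

lemma isCompact_convexHull_affineBasis [Finite ι] (b : AffineBasis ι ℝ V) :
    IsCompact (convexHull ℝ (Set.range b)) :=
  (Set.finite_range b).isCompact_convexHull ℝ

variable [FiniteDimensional ℝ V] [MeasurableSpace V] [BorelSpace V]

/-- The linear part is an involution, so its determinant is ±1; what is left of the map is a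
translation. -/
lemma measurePreserving_vertexSwap (b : AffineBasis ι ℝ V) {i j : ι} (hij : i ≠ j) :
    MeasurePreserving (vertexSwap b i j) volume volume := by
  set A := vertexSwap b i j
  have hlin : ∀ w, A.linear (A.linear w) = w := by
    intro w
    have h1 : A.linear w = A w - A 0 := by simpa using A.linearMap_vsub w 0
    have h2 : A.linear (A w - A 0) = A (A w) - A (A 0) := by
      simpa using A.linearMap_vsub (A w) (A 0)
    rw [h1, h2, vertexSwap_vertexSwap b hij, vertexSwap_vertexSwap b hij, sub_zero]
  have hdet : LinearMap.det A.linear * LinearMap.det A.linear = 1 := by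
    rw [← LinearMap.det_comp]
    have : A.linear ∘ₗ A.linear = LinearMap.id := LinearMap.ext hlin
    rw [this, LinearMap.det_id]
  have hne : LinearMap.det A.linear ≠ 0 := by
    intro h; simp [h] at hdet
  have habs : |(LinearMap.det A.linear)⁻¹| = 1 := by
    rcases mul_self_eq_one_iff.1 hdet with h | h <;> simp [h]
  have hmp : MeasurePreserving A.linear volume volume := by
    refine ⟨A.linear.continuous_of_finiteDimensional.measurable, ?_⟩
    rw [Measure.map_linearMap_addHaar_eq_smul_addHaar _ hne, habs]; simp
  have hA : (A : V → V) = (fun x => x + A 0) ∘ A.linear := by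
    funext x
    have h1 : A.linear x = A x - A 0 := by simpa using A.linearMap_vsub x 0
    simp [h1]
  rw [hA]
  exact (measurePreserving_add_right volume (A 0)).comp hmp

lemma integral_coord_convexHull_eq (b : AffineBasis ι ℝ V) (i j : ι) :
    ∫ x in convexHull ℝ (Set.range b), b.coord i x
      = ∫ x in convexHull ℝ (Set.range b), b.coord j x := by
  by_cases hij : i = j
  · rw [hij]
  have hmp := measurePreserving_vertexSwap b hij
  have hemb : MeasurableEmbedding (vertexSwap b i j) := by
    let e : V ≃ₜ V :=
      { toFun := vertexSwap b i j
        invFun := vertexSwap b i j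
        left_inv := vertexSwap_vertexSwap b hij
        right_inv := vertexSwap_vertexSwap b hij
        continuous_toFun := (vertexSwap b i j).continuous_of_finiteDimensional
        continuous_invFun := (vertexSwap b i j).continuous_of_finiteDimensional }
    exact e.measurableEmbedding
  rw [← hmp.setIntegral_preimage_emb hemb, vertexSwap_preimage_convexHull b hij]
  simp only [coord_vertexSwap_left b hij]

/-- The integral of an affine map over a simplex is the volume times the mean of the values at
the vertices. -/
lemma integral_affineMap_convexHull [Fintype ι] [CompleteSpace E] (b : AffineBasis ι ℝ V)
    (f : V →ᵃ[ℝ] E) :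
    ∫ x in convexHull ℝ (Set.range b), f x
      = (volume.real (convexHull ℝ (Set.range b)) / Fintype.card ι) • ∑ i, f (b i) := by
  have hc := isCompact_convexHull_affineBasis b
  have hint : ∀ i, IntegrableOn (b.coord i) (convexHull ℝ (Set.range b)) := fun i =>
    ((b.coord i).continuous_of_finiteDimensional.continuousOn).integrableOn_compact hc
  obtain ⟨i₀⟩ := b.nonempty
  -- By symmetry all coordinates have the same integral, and since they sum to one these integrals
  -- share the volume equally.
  have hsum : (Fintype.card ι : ℝ) * ∫ x in convexHull ℝ (Set.range b), b.coord i₀ x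
      = volume.real (convexHull ℝ (Set.range b)) := by
    have : ∑ i, ∫ x in convexHull ℝ (Set.range b), b.coord i x
        = volume.real (convexHull ℝ (Set.range b)) := by
      rw [← integral_finsetSum _ (fun i _ => hint i)]
      simp
    rw [← this, Finset.sum_congr rfl fun i _ => integral_coord_convexHull_eq b i i₀]
    simp
  have hcard : (Fintype.card ι : ℝ) ≠ 0 := by
    have : Nonempty ι := ⟨i₀⟩
    exact_mod_cast Fintype.card_ne_zero
  have hi : ∀ i, ∫ x in convexHull ℝ (Set.range b), b.coord i x
      = volume.real (convexHull ℝ (Set.range b)) / Fintype.card ι := fun i => by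
    rw [integral_coord_convexHull_eq b i i₀, eq_div_iff hcard, mul_comm, hsum]
  have hf : ∀ x, f x = ∑ i, b.coord i x • f (b i) := affineMap_eq_sum_coord b f
  rw [setIntegral_congr_fun hc.measurableSet fun x _ => hf x,
    integral_finsetSum _ (fun i _ => (hint i).smul_const _), Finset.smul_sum]
  refine Finset.sum_congr rfl fun i _ => ?_
  rw [integral_smul_const, hi]

end AffineBasis

/-! ### Simplices spanned by finite sets of points -/

section Simplex

variable {V E : Type*} [NormedAddCommGroup V] [InnerProductSpace ℝ V]
  [NormedAddCommGroup E]

/-- Transport of integrals over a lower-dimensional simplex to its affine hull. -/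
lemma exists_simplex_chart (s : Finset V) {n : ℕ}
    (hs : AffineIndependent ℝ ((↑) : s → V)) (hcard : s.card = n + 1) :
    ∃ (W : Submodule ℝ V) (b : AffineBasis s ℝ W) (L : W →ᵃ[ℝ] V), finrank ℝ W = n ∧
      Isometry L ∧ (∀ x, L (b x) = x) ∧ L ⁻¹' convexHull ℝ (s : Set V) = convexHull ℝ (Set.range b)
      ∧ convexHull ℝ (s : Set V) ⊆ Set.range L := by
  obtain ⟨p, hp⟩ : s.Nonempty := by rw [← Finset.card_pos]; omega
  set W := vectorSpan ℝ (Set.range ((↑) : s → V)) with hW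
  have hfin : finrank ℝ W = n := hs.finrank_vectorSpan (by simpa using hcard)
  let L : W →ᵃ[ℝ] V := W.subtype.toAffineMap + AffineMap.const ℝ W p
  have hL : ∀ w, L w = w + p := fun w => rfl
  have hiso : Isometry L := by
    refine Isometry.of_dist_eq fun x y => ?_
    rw [hL, hL, dist_add_right]; rfl
  have hmem : ∀ x : s, (x : V) - p ∈ W := fun x =>
    vsub_mem_vectorSpan ℝ (Set.mem_range_self x) ⟨⟨p, hp⟩, rfl⟩
  let v : s → W := fun x => ⟨x - p, hmem x⟩
  have hLv : ∀ x, L (v x) = x := fun x => by simp [hL, v]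
  have hind : AffineIndependent ℝ v := by
    refine AffineIndependent.of_comp L ?_
    have : L ∘ v = ((↑) : s → V) := funext hLv
    rwa [this]
  have htop : affineSpan ℝ (Set.range v) = ⊤ := by
    rw [hind.affineSpan_eq_top_iff_card_eq_finrank_add_one, hfin]; simpa using hcard
  have himg : L '' convexHull ℝ (Set.range v) = convexHull ℝ (s : Set V) := by
    rw [AffineMap.image_convexHull, ← Set.range_comp, show L ∘ v = ((↑) : s → V) from funext hLv]
    simp
  refine ⟨W, ⟨v, hind, htop⟩, L, hfin, hiso, hLv, ?_, ?_⟩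
  · rw [← himg, Set.preimage_image_eq _ hiso.injective]; rfl
  · rw [← himg]; exact Set.image_subset_range _ _

lemma measurableSet_convexHull_finset [MeasurableSpace V] [BorelSpace V] (s : Finset V) :
    MeasurableSet (convexHull ℝ (s : Set V)) :=
  (s.finite_toSet.isCompact_convexHull ℝ).measurableSet

variable [FiniteDimensional ℝ V]

/-- The affine basis given by the vertices of a full-dimensional simplex. -/
noncomputable def simplexBasis (K : Finset V) (hK : AffineIndependent ℝ ((↑) : K → V))
    (hcard : K.card = finrank ℝ V + 1) : AffineBasis K ℝ V :=
  ⟨(↑), hK, by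
    rw [hK.affineSpan_eq_top_iff_card_eq_finrank_add_one]; simpa using hcard⟩

@[simp] lemma simplexBasis_apply (K : Finset V) (hK : AffineIndependent ℝ ((↑) : K → V))
    (hcard : K.card = finrank ℝ V + 1) (x : K) : simplexBasis K hK hcard x = x := rfl

lemma range_simplexBasis (K : Finset V) (hK : AffineIndependent ℝ ((↑) : K → V))
    (hcard : K.card = finrank ℝ V + 1) : Set.range (simplexBasis K hK hcard) = K :=
  Subtype.range_coe

variable [MeasurableSpace V] [BorelSpace V]

lemma euclideanHausdorffMeasure_convexHull_lt_top (s : Finset V) {n : ℕ}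
    (hs : AffineIndependent ℝ ((↑) : s → V)) (hcard : s.card = n + 1) :
    (μHE[n] : Measure V) (convexHull ℝ (s : Set V)) < ⊤ := by
  obtain ⟨W, b, L, hfin, hiso, hLb, hpre, hsub⟩ := exists_simplex_chart s hs hcard
  have h := hiso.euclideanHausdorffMeasure_preimage (d := n) (convexHull ℝ (s : Set V))
  rw [Set.inter_eq_left.2 hsub] at h
  rw [← h, hpre, ← hfin, InnerProductSpace.euclideanHausdorffMeasure_eq_volume]
  exact (isCompact_convexHull_affineBasis b).measure_lt_top

lemma integrableOn_convexHull_of_continuous (s : Finset V) {n : ℕ}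
    (hs : AffineIndependent ℝ ((↑) : s → V)) (hcard : s.card = n + 1) {f : V → E}
    (hf : Continuous f) :
    IntegrableOn f (convexHull ℝ (s : Set V)) (μHE[n] : Measure V) :=
  hf.continuousOn.integrableOn_of_subset_isCompact
    (s.finite_toSet.isCompact_convexHull ℝ) (measurableSet_convexHull_finset s) subset_rfl
    (euclideanHausdorffMeasure_convexHull_lt_top s hs hcard).ne

/-- The surface integral of an affine map over a simplex is the surface measure times the mean of
the values at the vertices. -/
lemma surfaceIntegral_affineMap_convexHull [NormedSpace ℝ E] [CompleteSpace E] (s : Finset V) {n : ℕ}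
    (hs : AffineIndependent ℝ ((↑) : s → V)) (hcard : s.card = n + 1) (f : V →ᵃ[ℝ] E) :
    ∫ x in convexHull ℝ (s : Set V), f x ∂(μHE[n] : Measure V)
      = ((μHE[n] : Measure V).real (convexHull ℝ (s : Set V)) / (n + 1 : ℝ)) • ∑ x ∈ s, f x := by
  obtain ⟨W, b, L, hfin, hiso, hLb, hpre, hsub⟩ := exists_simplex_chart s hs hcard
  have hemb : MeasurableEmbedding L := hiso.isClosedEmbedding.measurableEmbedding
  have hvol : (μHE[n] : Measure W) = volume := by
    rw [← hfin, InnerProductSpace.euclideanHausdorffMeasure_eq_volume]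
  have hm := hiso.map_euclideanHausdorffMeasure (d := n)
  rw [hvol] at hm
  -- On the simplex, surface measure is the image of Lebesgue measure on the direction space under
  -- the isometric chart, so the full-dimensional formula applies there.
  have hres : (μHE[n] : Measure V).restrict (convexHull ℝ (s : Set V))
      = (Measure.map L volume).restrict (convexHull ℝ (s : Set V)) := by
    rw [hm, Measure.restrict_restrict (measurableSet_convexHull_finset s),
      Set.inter_eq_left.2 hsub]
  have harea : (μHE[n] : Measure V).real (convexHull ℝ (s : Set V))
      = volume.real (convexHull ℝ (Set.range b)) := by
    rw [← measureReal_restrict_apply_self, hres, measureReal_restrict_apply_self,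
      measureReal_def, hemb.map_apply, hpre, measureReal_def]
  rw [hres, hemb.setIntegral_map, hpre, harea]
  have h := integral_affineMap_convexHull b (f.comp L)
  simp only [AffineMap.coe_comp, Function.comp_apply, hLb] at h
  rw [h, Finset.sum_coe_sort s (fun x => f x)]
  simp [hcard]

end Simplex

/-! ### Cones and the divergence theorem -/

lemma inner_sub_eq_of_mem_convexHull {V : Type*} [NormedAddCommGroup V] [InnerProductSpace ℝ V]
    {s : Set V} {n x : V} {c : ℝ} (h : ∀ y ∈ s, inner ℝ n (y - x) = c) {y : V}
    (hy : y ∈ convexHull ℝ s) : inner ℝ n (y - x) = c := by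
  have hconv : Convex ℝ {y : V | inner ℝ n (y - x) = c} := by
    intro y hy z hz a b ha hb hab
    have hxx : a • y + b • z - x = a • (y - x) + b • (z - x) := by
      have : x = (a + b) • x := by rw [hab, one_smul]
      nth_rewrite 1 [this]; module
    simp only [Set.mem_ofPred_eq] at hy hz ⊢
    rw [hxx, inner_add_right, inner_smul_right, inner_smul_right, hy, hz, ← add_mul, hab, one_mul]
  exact convexHull_min h hconv hy

/-- Orthogonal sections of the cone with apex `x` over a simplex at constant height `h`. -/
lemma cone_inter_section {V : Type*} [NormedAddCommGroup V] [InnerProductSpace ℝ V]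
    {s : Set V} (hs : s.Nonempty) {n x : V} {h : ℝ} (hn : ‖n‖ = 1) (hh : 0 < h)
    (hy : ∀ y ∈ s, inner ℝ n (y - x) = h) (r : ℝ) :
    convexHull ℝ (insert x s) ∩ AffineSubspace.mk' (r • (h • n) +ᵥ x) (ℝ ∙ (h • n))ᗮ
      = if r ∈ Set.Icc (0 : ℝ) 1 then AffineMap.homothety x r '' convexHull ℝ s else ∅ := by
  have hsec : ∀ z : V, z ∈ AffineSubspace.mk' (r • (h • n) +ᵥ x) (ℝ ∙ (h • n))ᗮ
      ↔ inner ℝ n (z - x) = r * h := by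
    intro z
    rw [AffineSubspace.mem_mk', Submodule.mem_orthogonal_singleton_iff_inner_right,
      inner_smul_left, vsub_eq_sub, vadd_eq_add,
      show z - (r • (h • n) + x) = (z - x) - (r * h) • n by rw [mul_smul]; abel,
      inner_sub_right, inner_smul_right, real_inner_self_eq_norm_sq, hn]
    simp [hh.ne', sub_eq_zero]
  have hcone : ∀ z : V, z ∈ convexHull ℝ (insert x s) ↔
      ∃ y ∈ convexHull ℝ s, ∃ t ∈ Set.Icc (0 : ℝ) 1, z = AffineMap.homothety x t y := by
    intro z
    rw [convexHull_insert hs, convexJoin_singleton_left]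
    simp only [Set.mem_iUnion, segment_eq_image_lineMap, Set.mem_image, exists_prop]
    constructor
    · rintro ⟨y, hy, t, ht, rfl⟩
      exact ⟨y, hy, t, ht, by simp [AffineMap.homothety_eq_lineMap]⟩
    · rintro ⟨y, hy, t, ht, rfl⟩
      exact ⟨y, hy, t, ht, by simp [AffineMap.homothety_eq_lineMap]⟩
  have hheight : ∀ y ∈ convexHull ℝ s, ∀ t : ℝ,
      inner ℝ n (AffineMap.homothety x t y - x) = t * h := by
    intro y hy' t
    rw [AffineMap.homothety_apply, vsub_eq_sub, vadd_eq_add, add_sub_cancel_right,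
      inner_smul_right, inner_sub_eq_of_mem_convexHull hy hy']
  ext z
  simp only [Set.mem_inter_iff, SetLike.mem_coe, hsec, hcone]
  split_ifs with hr
  · constructor
    · rintro ⟨⟨y, hy', t, ht, rfl⟩, hz⟩
      rw [hheight y hy'] at hz
      rw [← mul_right_cancel₀ hh.ne' hz]
      exact ⟨y, hy', rfl⟩
    · rintro ⟨y, hy', rfl⟩
      exact ⟨⟨y, hy', r, hr, rfl⟩, hheight y hy' r⟩
  · simp only [Set.mem_empty_iff_false, iff_false, not_and]
    rintro ⟨y, hy', t, ht, rfl⟩ hz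
    rw [hheight y hy'] at hz
    exact hr (mul_right_cancel₀ hh.ne' hz ▸ ht)

/-- The volume of the cone over a simplex of codimension one is `height * area / dimension`. -/
lemma volume_cone {d : ℕ} (hd : 0 < d) (s : Finset (Pt d)) (hs : s.Nonempty) {n x : Pt d} {h : ℝ}
    (hn : ‖n‖ = 1) (hh : 0 < h) (hy : ∀ y ∈ s, inner ℝ n (y - x) = h) :
    volume.real (convexHull ℝ (insert x (s : Set (Pt d))))
      = h / d * (μHE[d - 1] : Measure (Pt d)).real (convexHull ℝ (s : Set (Pt d))) := by
  have hv : h • n ≠ 0 := by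
    rw [← norm_ne_zero_iff, norm_smul, hn]; simpa using hh.ne'
  have hmeas : MeasurableSet (convexHull ℝ (insert x (s : Set (Pt d)))) :=
    ((s.finite_toSet.insert x).isCompact_convexHull ℝ).measurableSet
  -- Slicing orthogonally to `h • n`: the section at parameter `r` is the base scaled by `r`, hence
  -- the factor `r ^ (d - 1)`, whose integral over the unit interval is `1 / d`; the length of `h •
  -- n` supplies the height.
  have key := EuclideanGeometry.euclideanHausdorffMeasure_eq_lintegral x hv hmeas
  rw [finrank_euclideanSpace_fin, EuclideanSpace.euclideanHausdorffMeasure_eq_volume] at key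
  set m := (μHE[d - 1] : Measure (Pt d)) (convexHull ℝ (s : Set (Pt d))) with hm
  have hsec : ∀ᵐ r : ℝ, (μHE[d - 1] : Measure (Pt d)) (convexHull ℝ (insert x (s : Set (Pt d))) ∩
      AffineSubspace.mk' (r • (h • n) +ᵥ x) (ℝ ∙ (h • n))ᗮ)
      = (Set.Icc (0 : ℝ) 1).indicator (fun r => ENNReal.ofReal (r ^ (d - 1)) * m) r := by
    -- The apex section is discarded because the scaling formula for homotheties is applied with a
    -- nonzero ratio.
    have h0 : ∀ᵐ r : ℝ, r ≠ 0 := by simp [ae_iff]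
    filter_upwards [h0] with r hr0
    rw [cone_inter_section (by simpa using hs) hn hh (by simpa using hy) r]
    by_cases hr : r ∈ Set.Icc (0 : ℝ) 1
    · rw [if_pos hr, Set.indicator_of_mem hr,
        euclideanHausdorffMeasure_homothety_image _ _ hr0, ← hm, ENNReal.smul_def, smul_eq_mul]
      congr 1
      rw [ENNReal.ofReal, Real.toNNReal_pow hr.1]
      congr 2
      ext; simp [hr.1, abs_of_nonneg]
    · rw [if_neg hr, Set.indicator_of_notMem hr, measure_empty]
  rw [lintegral_congr_ae hsec, lintegral_indicator measurableSet_Icc,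
    lintegral_mul_const _ (by fun_prop)] at key
  have hint : ∫⁻ r in Set.Icc (0 : ℝ) 1, ENNReal.ofReal (r ^ (d - 1)) = ENNReal.ofReal (1 / d) := by
    rw [← ofReal_integral_eq_lintegral_ofReal]
    · rw [integral_Icc_eq_integral_Ioc, ← intervalIntegral.integral_of_le zero_le_one,
        integral_pow]
      have : ((d - 1 : ℕ) : ℝ) + 1 = d := by
        rw [← Nat.cast_add_one, Nat.sub_add_cancel hd]
      rw [this]; simp
    · exact (by fun_prop : Continuous fun r : ℝ => r ^ (d - 1)).continuousOn.integrableOn_compact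
        isCompact_Icc
    · filter_upwards [ae_restrict_mem measurableSet_Icc] with r hr using pow_nonneg hr.1 _
  rw [hint] at key
  rw [measureReal_def, key, measureReal_def, ← hm, ENNReal.toReal_mul, ENNReal.toReal_mul,
    ENNReal.toReal_ofReal (by positivity), toReal_enorm, norm_smul, hn, Real.norm_of_nonneg hh.le]
  ring

section Divergence

variable {d : ℕ} (K : Finset (Pt d)) (hK : AffineIndependent ℝ ((↑) : K → Pt d))
  (hcard : K.card = finrank ℝ (Pt d) + 1)

/-- The differential of `u` is the sum over vertices of `u x` tensored with the differential of the
coordinate of `x`; taking the trace evaluates that differential at `u x`. -/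
lemma divg_eq_sum_coord (u : Pt d →ᵃ[ℝ] Pt d) :
    divg u = ∑ x : K, ((simplexBasis K hK hcard).coord x).linear (u x) := by
  set b := simplexBasis K hK hcard
  have h1 : ∀ x : K, (b.coord x).linear (u x)
      = ∑ i, u x i * (b.coord x).linear (EuclideanSpace.single i (1 : ℝ)) := by
    intro x
    conv_lhs => rw [← (EuclideanSpace.basisFun (Fin d) ℝ).sum_repr (u x)]
    simp [map_sum]
  simp only [h1, divg, partialDeriv]
  rw [Finset.sum_comm]
  refine Finset.sum_congr rfl fun i _ => ?_
  rw [affineMap_linear_eq_sum_coord b u]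
  simp [b, mul_comm]

/-- The linear form `⟪n, ·⟫` with `n` normal to a face, in terms of the barycentric coordinate of
the opposite vertex. -/
lemma inner_eq_coord_linear {n : Pt d} (x : K) {c : ℝ} {y₀ : Pt d} (hy₀ : inner ℝ n (x - y₀) = c)
    (hy : ∀ y ∈ K, y ≠ x → inner ℝ n (y - y₀) = 0) (w : Pt d) :
    inner ℝ n w = c * ((simplexBasis K hK hcard).coord x).linear w := by
  set b := simplexBasis K hK hcard
  let f : Pt d →ᵃ[ℝ] ℝ := (innerₛₗ ℝ n).toAffineMap.comp (AffineMap.id ℝ _ - AffineMap.const ℝ _ y₀)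
  have hf : ∀ q, f q = inner ℝ n (q - y₀) := fun q => rfl
  have hlin : f.linear w = inner ℝ n w := by
    have : f.linear w = f w - f 0 := by simpa using f.linearMap_vsub w 0
    rw [this, hf, hf, ← inner_sub_right]; simp
  rw [← hlin, affineMap_linear_eq_sum_coord b f w, Finset.sum_eq_single x]
  · simp only [b, simplexBasis_apply, hf, hy₀, smul_eq_mul, mul_comm]
  · intro y _ hyx
    simp only [b, simplexBasis_apply, hf]
    rw [hy y y.2 (fun h => hyx (Subtype.ext h)), smul_zero]
  · simp

/-- The flux of an affine field through a face of a simplex. -/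
lemma inner_surfaceIntegral_face (hd : 0 < d) (u : Pt d →ᵃ[ℝ] Pt d) (x : K) {n : Pt d}
    (hn : ‖n‖ = 1)
    (horth : ∀ y ∈ K, ∀ z ∈ K, y ≠ x → z ≠ x → inner ℝ n (y - z) = 0)
    (hneg : ∀ y ∈ K, y ≠ x → inner ℝ n (x - y) < 0) [DecidableEq (Pt d)] :
    inner ℝ (∫ y in convexHull ℝ (K.erase x : Set (Pt d)), u y ∂(μHE[d - 1] : Measure (Pt d))) n
      = - volume.real (convexHull ℝ (K : Set (Pt d))) *
        ((simplexBasis K hK hcard).coord x).linear (∑ y ∈ K.erase x, u y) := by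
  have hcard' : (K.erase x).card = (d - 1) + 1 := by
    rw [Finset.card_erase_of_mem x.2, hcard, finrank_euclideanSpace_fin]; omega
  have hne : (K.erase (x : Pt d)).Nonempty := by rw [← Finset.card_pos]; omega
  obtain ⟨y₀, hy₀⟩ := hne
  obtain ⟨hy₀x, hy₀K⟩ := Finset.mem_erase.1 hy₀
  have hlin := inner_eq_coord_linear K hK hcard x (n := n) (y₀ := y₀) rfl
    (fun y hy hyx => horth y hy y₀ hy₀K hyx hy₀x)
  have hpos : 0 < -inner ℝ n (x - y₀) := neg_pos.2 (hneg y₀ hy₀K hy₀x)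
  have hvol := volume_cone hd (K.erase x) ⟨y₀, hy₀⟩ (x := x) hn hpos (by
    intro y hy
    obtain ⟨hyx, hyK⟩ := Finset.mem_erase.1 hy
    have h1 := horth y hyK y₀ hy₀K hyx hy₀x
    rw [← inner_neg_right, neg_sub, ← sub_eq_zero, ← inner_sub_right]
    simpa using h1)
  rw [← Finset.coe_insert, Finset.insert_erase x.2] at hvol
  have hdpos : (0 : ℝ) < d := by exact_mod_cast hd
  have hd1 : ((d - 1 : ℕ) : ℝ) + 1 = d := by rw [← Nat.cast_add_one, Nat.sub_add_cancel hd]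
  -- The `1 / d` from averaging over the `d` vertices of the face is exactly the one in the cone
  -- volume, so height times area over `d` becomes the volume of the element.
  rw [surfaceIntegral_affineMap_convexHull _
    (hK.mono (Finset.erase_subset _ _)) hcard', inner_smul_left,
    real_inner_comm, hlin, hvol, hd1]
  simp only [conj_trivial]
  field_simp

end Divergence

/-- The divergence theorem for affine fields on a simplex; `G x` is the outward flux through the
face opposite to the vertex `x`. -/
lemma divergence_simplex {d : ℕ} [DecidableEq (Pt d)] (hd : 0 < d) (K : Finset (Pt d))
    (hK : AffineIndependent ℝ ((↑) : K → Pt d)) (hcard : K.card = finrank ℝ (Pt d) + 1)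
    (u : Pt d →ᵃ[ℝ] Pt d) (G : Pt d → ℝ)
    (hG : ∀ x ∈ K, ∃ n : Pt d, ‖n‖ = 1 ∧
      (∀ y ∈ K, ∀ z ∈ K, y ≠ x → z ≠ x → inner ℝ n (y - z) = 0) ∧
      (∀ y ∈ K, y ≠ x → inner ℝ n (x - y) < 0) ∧
      G x = inner ℝ (∫ y in convexHull ℝ (K.erase x : Set (Pt d)), u y
        ∂(μHE[d - 1] : Measure (Pt d))) n) :
    ∑ x ∈ K, G x = volume.real (convexHull ℝ (K : Set (Pt d))) * divg u := by
  set b := simplexBasis K hK hcard with hb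
  rw [divg_eq_sum_coord K hK hcard, ← Finset.sum_coe_sort, Finset.mul_sum]
  -- The vertex sum over a face is the full vertex sum minus the opposite vertex. The full sum does
  -- not depend on the face, so its contributions cancel in total.
  have h1 : ∀ x : K, G x = volume.real (convexHull ℝ (K : Set (Pt d))) * (b.coord x).linear (u x)
      - volume.real (convexHull ℝ (K : Set (Pt d))) * (b.coord x).linear (∑ y ∈ K, u y) := by
    intro x
    obtain ⟨n, hn, horth, hneg, hx⟩ := hG x x.2
    rw [hx, inner_surfaceIntegral_face K hK hcard hd u x hn horth hneg,
      ← Finset.add_sum_erase K u x.2, map_add]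
    ring
  rw [Finset.sum_congr rfl fun x _ => h1 x, Finset.sum_sub_distrib, ← Finset.mul_sum _ _
    (volume.real _), ← Finset.mul_sum, sum_coord_linear_eq_zero]
  simp [Finset.mul_sum, hb]

/-! ### Elements adjacent to a face -/

/-- Two simplices with a common face whose remaining vertices lie strictly on the same side of
that face have a common point off the face. -/
lemma exists_common_point_off_face {d : ℕ} (K : Finset (Pt d))
    (hK : AffineIndependent ℝ ((↑) : K → Pt d)) (hcard : K.card = finrank ℝ (Pt d) + 1)
    {σ : Finset (Pt d)} (hσ : σ.Nonempty) {x x' n y₀ : Pt d} (hx : x ∈ K)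
    (hKσ : ∀ y ∈ K, y ≠ x ↔ y ∈ σ) (hσK : σ ⊆ K)
    (hy₀ : ∀ y ∈ σ, inner ℝ n (y - y₀) = 0)
    (hside : 0 < inner ℝ n (x - y₀) * inner ℝ n (x' - y₀)) :
    ∃ z, z ∈ convexHull ℝ (K : Set (Pt d)) ∧ z ∈ convexHull ℝ (insert x' (σ : Set (Pt d))) ∧
      inner ℝ n (z - y₀) ≠ 0 := by
  set b := simplexBasis K hK hcard with hb
  -- The common point is found by moving slightly from the centroid of the face towards `x'`: the
  -- coordinates of the face vertices are positive at `c` and stay so by continuity.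
  set c := σ.centroid ℝ id with hc
  have hcσ : c ∈ convexHull ℝ (σ : Set (Pt d)) := σ.centroid_mem_convexHull hσ
  have hn0 : inner ℝ n (c - y₀) = 0 := inner_sub_eq_of_mem_convexHull hy₀ hcσ
  have hlin := inner_eq_coord_linear K hK hcard ⟨x, hx⟩ (n := n) (y₀ := y₀) rfl
    (fun y hy hyx => hy₀ y ((hKσ y hy).1 hyx))
  have hcoord : ∀ y : K, (y : Pt d) ≠ x → 0 < b.coord y c := by
    intro y hyx
    have hw := σ.sum_centroidWeights_eq_one_of_nonempty ℝ hσ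
    rw [hc, Finset.centroid_def, Finset.map_affineCombination _ _ _ hw,
      Finset.affineCombination_eq_linear_combination _ _ _ hw]
    have hcardpos : (0 : ℝ) < (σ.card : ℝ)⁻¹ :=
      inv_pos.2 (Nat.cast_pos.2 hσ.card_pos)
    have hval : ∀ y' (hy' : y' ∈ σ), b.coord y y' = if y = ⟨y', hσK hy'⟩ then 1 else 0 :=
      fun y' hy' => b.coord_apply y ⟨y', hσK hy'⟩
    refine Finset.sum_pos' (fun y' hy' => ?_) ⟨y, (hKσ y y.2).1 hyx, ?_⟩
    · simp only [Finset.centroidWeights_apply, Function.comp_apply, id, smul_eq_mul]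
      rw [hval y' hy']
      split_ifs <;> simp
    · simp only [Finset.centroidWeights_apply, Function.comp_apply, id, smul_eq_mul]
      rw [hval y ((hKσ y y.2).1 hyx), if_pos rfl, mul_one]
      exact hcardpos
  have hcont : ∀ y : K, Continuous fun t : ℝ => b.coord y (AffineMap.lineMap c x' t) := fun y =>
    ((b.coord y).continuous_of_finiteDimensional).comp AffineMap.lineMap_continuous
  have hev : ∀ᶠ t in nhds (0 : ℝ), ∀ y : K, (y : Pt d) ≠ x →
      0 < b.coord y (AffineMap.lineMap c x' t) := by
    rw [Filter.eventually_all]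
    intro y
    by_cases hyx : (y : Pt d) = x
    · exact Filter.Eventually.of_forall fun t h => absurd hyx h
    have h0 : 0 < b.coord y (AffineMap.lineMap c x' (0 : ℝ)) := by
      rw [AffineMap.lineMap_apply_zero]; exact hcoord y hyx
    filter_upwards [(hcont y).continuousAt.eventually_const_lt h0] with t ht _ using ht
  obtain ⟨t, ht1, ht⟩ : ∃ t ∈ Set.Ioo (0 : ℝ) 1, ∀ y : K, (y : Pt d) ≠ x →
      0 < b.coord y (AffineMap.lineMap c x' t) := by
    have h1 : ∀ᶠ t in nhdsWithin (0 : ℝ) (Set.Ioi 0), t ∈ Set.Ioo (0 : ℝ) 1 :=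
      Ioo_mem_nhdsGT one_pos
    exact (h1.and (hev.filter_mono nhdsWithin_le_nhds)).exists
  set z := AffineMap.lineMap c x' t with hz
  have hnz : inner ℝ n (z - y₀) = t * inner ℝ n (x' - y₀) := by
    have : z - y₀ = (1 - t) • (c - y₀) + t • (x' - y₀) := by
      rw [hz, AffineMap.lineMap_apply_module]; module
    rw [this, inner_add_right, inner_smul_right, inner_smul_right, hn0]; ring
  have hx0 : inner ℝ n (x - y₀) ≠ 0 := left_ne_zero_of_mul hside.ne'
  have hx'0 : inner ℝ n (x' - y₀) ≠ 0 := right_ne_zero_of_mul hside.ne'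
  -- The coordinate at `x` is proportional to the height above the face. Having `x` and `x'` on the
  -- same side makes it positive along the way to `x'`.
  have hcx : 0 < b.coord ⟨x, hx⟩ z := by
    obtain ⟨y, hy⟩ := hσ
    have h1 : (b.coord ⟨x, hx⟩).linear (z - y) = b.coord ⟨x, hx⟩ z - b.coord ⟨x, hx⟩ y := by
      simpa using (b.coord ⟨x, hx⟩).linearMap_vsub z y
    have h2 : b.coord ⟨x, hx⟩ y = 0 :=
      b.coord_apply_ne (i := ⟨x, hx⟩) (j := ⟨y, hσK hy⟩)
        (fun h => (hKσ y (hσK hy)).2 hy (congrArg Subtype.val h).symm)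
    have h3 := hlin (z - y)
    rw [h1, h2, sub_zero] at h3
    have h4 : inner ℝ n (z - y) = t * inner ℝ n (x' - y₀) := by
      rw [← hnz, ← sub_eq_zero, ← inner_sub_right]
      have := hy₀ y hy
      rw [show z - y - (z - y₀) = -(y - y₀) by abel, inner_neg_right, this, neg_zero]
    rw [h4] at h3
    have h5 : 0 < inner ℝ n (x - y₀) ^ 2 * b.coord ⟨x, hx⟩ z := by
      have := mul_pos ht1.1 hside
      calc 0 < t * (inner ℝ n (x - y₀) * inner ℝ n (x' - y₀)) := this
        _ = inner ℝ n (x - y₀) * (t * inner ℝ n (x' - y₀)) := by ring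
        _ = _ := by rw [h3]; ring
    exact pos_of_mul_pos_right h5 (sq_nonneg _)
  refine ⟨z, ?_, ?_, ?_⟩
  · rw [← range_simplexBasis K hK hcard, b.convexHull_eq_nonneg_coord]
    intro y
    by_cases hyx : (y : Pt d) = x
    · have : y = ⟨x, hx⟩ := Subtype.ext hyx
      rw [this]; exact hcx.le
    · exact (ht y hyx).le
  · refine (convex_convexHull ℝ _).segment_subset
      (convexHull_mono (Set.subset_insert _ _) hcσ) (subset_convexHull ℝ _ (Set.mem_insert _ _)) ?_
    rw [segment_eq_image_lineMap]
    exact ⟨t, ⟨ht1.1.le, ht1.2.le⟩, rfl⟩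
  · rw [hnz]; exact mul_ne_zero ht1.1.ne' hx'0

namespace Triangulation

variable {d : ℕ} {Ω : Set (Pt d)} {T : Triangulation d Ω}

lemma card_cell (K : T.Cell) : K.1.card = finrank ℝ (Pt d) + 1 := by
  rw [finrank_euclideanSpace_fin]; exact T.card_eq K.1 K.2

lemma card_face (σ : T.Face) : σ.1.card = d := by
  obtain ⟨σ, hσ⟩ := σ
  simp only [faces, Finset.mem_biUnion, Finset.mem_powersetCard] at hσ
  obtain ⟨K, -, -, h⟩ := hσ
  exact h

lemma face_nonempty (hd : 0 < d) (σ : T.Face) : σ.1.Nonempty := by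
  rw [← Finset.card_pos, card_face]; exact hd

lemma exists_opposite_vertex {σ : T.Face} {K : T.Cell} (h : σ.1 ⊆ K.1) :
    ∃ x ∈ K.1, x ∉ σ.1 ∧ ∀ y ∈ K.1, y ≠ x ↔ y ∈ σ.1 := by
  classical
  have hc : (K.1 \ σ.1).card = 1 := by
    rw [Finset.card_sdiff_of_subset h, card_face, T.card_eq _ K.2]; omega
  obtain ⟨x, hx⟩ := Finset.card_eq_one.1 hc
  have hmem : ∀ y, y ∈ K.1 ∧ y ∉ σ.1 ↔ y = x := fun y => by
    rw [← Finset.mem_sdiff, hx, Finset.mem_singleton]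
  refine ⟨x, ((hmem x).2 rfl).1, ((hmem x).2 rfl).2, fun y hy => ?_⟩
  rw [Ne, ← hmem]; tauto

/-- Two elements on the same side of a common face coincide. -/
lemma cell_eq_of_same_side (hd : 0 < d) {σ : T.Face} {K L : T.Cell} (hK : σ.1 ⊆ K.1)
    (hL : σ.1 ⊆ L.1) {n y₀ x x' : Pt d} (horth : ∀ y ∈ σ.1, inner ℝ n (y - y₀) = 0)
    (hx : x ∈ K.1) (hxσ : x ∉ σ.1) (hx' : x' ∈ L.1) (hx'σ : x' ∉ σ.1)
    (hside : 0 < inner ℝ n (x - y₀) * inner ℝ n (x' - y₀)) : K = L := by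
  classical
  by_contra hne
  obtain ⟨a, ha, haσ, hKa⟩ := exists_opposite_vertex hK
  obtain ⟨a', ha', ha'σ, hLa'⟩ := exists_opposite_vertex hL
  obtain rfl : x = a := by by_contra h; exact hxσ ((hKa x hx).1 h)
  obtain rfl : x' = a' := by by_contra h; exact hx'σ ((hLa' x' hx').1 h)
  obtain ⟨z, hzK, hzL, hz0⟩ := exists_common_point_off_face K.1 (T.indep _ K.2) (card_cell K)
    (face_nonempty hd σ) hx hKa hK horth hside
  have hsubL : insert x' (σ.1 : Set (Pt d)) ⊆ L.1 := Set.insert_subset hx' hL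
  have hz := T.conforming _ K.2 _ L.2 ⟨hzK, convexHull_mono hsubL hzL⟩
  -- Distinct elements sharing the face cannot share their remaining vertex too. Conformity then
  -- puts `z` in the face itself, where the height vanishes.
  have hinter : (K.1 : Set (Pt d)) ∩ L.1 ⊆ σ.1 := by
    rintro y ⟨hyK, hyL⟩
    by_contra hyσ
    have h1 : y = x := by by_contra h; exact hyσ ((hKa y hyK).1 h)
    have h2 : y = x' := by by_contra h; exact hyσ ((hLa' y hyL).1 h)
    apply hne
    apply Subtype.ext
    apply Finset.ext
    intro w
    constructor
    · intro hw
      by_cases hwx : w = x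
      · rw [hwx, ← h1]; exact hyL
      · exact hL ((hKa w hw).1 hwx)
    · intro hw
      by_cases hwx : w = x'
      · rw [hwx, ← h2]; exact hyK
      · exact hK ((hLa' w hw).1 hwx)
  exact hz0 (inner_sub_eq_of_mem_convexHull horth (convexHull_mono hinter hz))

/-- The normal to a face is transversal to the edges leaving the face. -/
lemma inner_normal_ne_zero (O : T.Orientation) {σ : T.Face} {K : T.Cell} (hK : σ.1 ⊆ K.1)
    {x y₀ : Pt d} (hy₀ : y₀ ∈ σ.1) (hx : x ∈ K.1) (hxσ : x ∉ σ.1) :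
    inner ℝ (O.normal σ) (x - y₀) ≠ 0 := by
  intro h0
  obtain ⟨a, ha, haσ, hKa⟩ := exists_opposite_vertex hK
  obtain rfl : x = a := by by_contra h; exact hxσ ((hKa x hx).1 h)
  -- If the opposite vertex also had height zero, the form `⟪n, ·⟫` would vanish identically, in
  -- particular at `n`, which has norm one.
  have hlin := inner_eq_coord_linear K.1 (T.indep _ K.2) (card_cell K) ⟨x, hx⟩
    (n := O.normal σ) (y₀ := y₀) h0
    (fun y hy hyx => O.normal_orthogonal σ y ((hKa y hy).1 hyx) y₀ hy₀) (O.normal σ)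
  rw [zero_mul, real_inner_self_eq_norm_sq, O.norm_normal] at hlin
  norm_num at hlin

/-- The vertex opposite the face lies strictly on one side of it, and each side is already occupied
by `O.inn σ` or `O.out σ`. Hence the cell sum at an interior face reduces to two terms. -/
lemma eq_inn_or_eq_out (hd : 0 < d) (O : T.Orientation) {σ : T.Face} (hσ : σ ∈ T.intFaces)
    {K : T.Cell} (hK : σ.1 ⊆ K.1) : K = O.inn σ ∨ K = O.out σ := by
  obtain ⟨y₀, hy₀⟩ := face_nonempty hd σ
  obtain ⟨x, hx, hxσ, -⟩ := exists_opposite_vertex hK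
  have horth : ∀ y ∈ σ.1, inner ℝ (O.normal σ) (y - y₀) = 0 := fun y hy =>
    O.normal_orthogonal σ y hy y₀ hy₀
  rcases (inner_normal_ne_zero O hK hy₀ hx hxσ).lt_or_gt with h | h
  · left
    obtain ⟨x', hx', hx'σ, -⟩ := exists_opposite_vertex (O.subset_inn σ)
    exact cell_eq_of_same_side hd hK (O.subset_inn σ) horth hx hxσ hx' hx'σ
      (mul_pos_of_neg_of_neg h (O.inner_inn σ y₀ hy₀ x' hx' hx'σ))
  · right
    obtain ⟨x', hx', hx'σ, -⟩ := exists_opposite_vertex (O.subset_out σ hσ)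
    exact cell_eq_of_same_side hd hK (O.subset_out σ hσ) horth hx hxσ hx' hx'σ
      (mul_pos h (O.inner_out σ hσ y₀ hy₀ x' hx' hx'σ))

lemma inn_ne_out (hd : 0 < d) (O : T.Orientation) {σ : T.Face} (hσ : σ ∈ T.intFaces) :
    O.inn σ ≠ O.out σ := by
  intro h
  obtain ⟨y₀, hy₀⟩ := face_nonempty hd σ
  obtain ⟨x, hx, hxσ, -⟩ := exists_opposite_vertex (O.subset_inn σ)
  have h1 := O.inner_inn σ y₀ hy₀ x hx hxσ
  have h2 := O.inner_out σ hσ y₀ hy₀ x (h ▸ hx) hxσ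
  exact lt_asymm h1 h2

/-! ### Fluxes of Crouzeix-Raviart fields -/

lemma affineIndependent_face (O : T.Orientation) (σ : T.Face) :
    AffineIndependent ℝ ((↑) : σ.1 → Pt d) :=
  (T.indep _ (O.inn σ).2).mono (O.subset_inn σ)

lemma card_face_eq_succ (hd : 0 < d) (σ : T.Face) : σ.1.card = d - 1 + 1 := by
  rw [card_face]; omega

lemma faceIntegral_sub (hd : 0 < d) (O : T.Orientation) (σ : T.Face) (f g : Pt d →ᵃ[ℝ] Pt d) :
    T.faceIntegral σ (fun x => f x - g x) = T.faceIntegral σ f - T.faceIntegral σ g :=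
  integral_sub
    (integrableOn_convexHull_of_continuous _ (affineIndependent_face O σ) (card_face_eq_succ hd σ)
      f.continuous_of_finiteDimensional)
    (integrableOn_convexHull_of_continuous _ (affineIndependent_face O σ) (card_face_eq_succ hd σ)
      g.continuous_of_finiteDimensional)

lemma faceIntegral_const (σ : T.Face) (c : ℝ) :
    T.faceIntegral σ (fun _ => c) = T.faceArea σ * c := by
  simp [faceIntegral, faceArea, measureReal_def]

lemma faceArea_mul_faceVel (hd : 0 < d) (O : T.Orientation) (u : T.PwAffine) (σ : T.Face) :
    T.faceArea σ * T.faceVel O u σ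
      = inner ℝ (T.faceIntegral σ (u (O.inn σ))) (O.normal σ) := by
  have h := surfaceIntegral_affineMap_convexHull σ.1 (affineIndependent_face O σ)
    (card_face_eq_succ hd σ) (u (O.inn σ))
  change T.faceIntegral σ (u (O.inn σ)) = (T.faceArea σ / _) • _ at h
  rw [faceVel]
  -- Positivity of the face area is not required: at zero area the vertex formula makes the integral
  -- vanish, in agreement with the value of the left-hand side.
  by_cases h0 : T.faceArea σ = 0
  · rw [h, h0]; simp
  · change _ * (_ * inner ℝ (T.faceIntegral σ (u (O.inn σ))) (O.normal σ)) = _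
    field_simp

open Classical in
/-- The outward flux of a field of the Crouzeix-Raviart space through a face of an element. -/
noncomputable def outFlux (O : T.Orientation) (u : T.PwAffine) (K : T.Cell) (σ : T.Face) : ℝ :=
  if σ ∈ T.intFaces then
    (if K = O.inn σ then T.faceArea σ * T.faceVel O u σ
      else -(T.faceArea σ * T.faceVel O u σ))
  else 0

/-- Matches `outFlux` with the fluxes required by `divergence_simplex`. From the `out` side the
normal is reversed and the zero mean of the jump allows exchanging the two traces. On an exterior
face the integral vanishes, so the sign of the normal matters only for pointing outwards; it is
chosen by the position of `x`, without knowing that `K` is `O.inn σ`. -/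
lemma exists_outward_normal (hd : 0 < d) {O : T.Orientation} {u : T.PwAffine}
    (hu : u ∈ T.crouzeixRaviart₀ O) {K : T.Cell} {σ : T.Face} (hσK : σ.1 ⊆ K.1) {x : Pt d}
    (hx : x ∈ K.1) (hKx : ∀ y ∈ K.1, y ≠ x ↔ y ∈ σ.1) :
    ∃ n : Pt d, ‖n‖ = 1 ∧ (∀ y ∈ K.1, ∀ z ∈ K.1, y ≠ x → z ≠ x → inner ℝ n (y - z) = 0) ∧
      (∀ y ∈ K.1, y ≠ x → inner ℝ n (x - y) < 0) ∧
      outFlux O u K σ = inner ℝ (T.faceIntegral σ (u K)) n := by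
  have hxσ : x ∉ σ.1 := fun h => (hKx x hx).2 h rfl
  have horth : ∀ y ∈ K.1, ∀ z ∈ K.1, y ≠ x → z ≠ x → inner ℝ (O.normal σ) (y - z) = 0 :=
    fun y hy z hz hyx hzx =>
      O.normal_orthogonal σ y ((hKx y hy).1 hyx) z ((hKx z hz).1 hzx)
  by_cases hσ : σ ∈ T.intFaces
  · by_cases hKi : K = O.inn σ
    · refine ⟨O.normal σ, O.norm_normal σ, horth, fun y hy hyx =>
        O.inner_inn σ y ((hKx y hy).1 hyx) x (hKi ▸ hx) hxσ, ?_⟩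
      rw [outFlux, if_pos hσ, if_pos hKi, faceArea_mul_faceVel hd, hKi]
    · have hKo : K = O.out σ := (eq_inn_or_eq_out hd O hσ hσK).resolve_left hKi
      refine ⟨-O.normal σ, by rw [norm_neg, O.norm_normal], fun y hy z hz hyx hzx => by
        rw [inner_neg_left, horth y hy z hz hyx hzx, neg_zero], fun y hy hyx => ?_, ?_⟩
      · rw [inner_neg_left, neg_lt_zero]
        exact O.inner_out σ hσ y ((hKx y hy).1 hyx) x (hKo ▸ hx) hxσ
      · have h := hu.1 σ hσ
        rw [faceIntegral_sub hd O, sub_eq_zero] at h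
        rw [outFlux, if_pos hσ, if_neg hKi, faceArea_mul_faceVel hd, inner_neg_right, hKo, h]
  · have hext : σ ∈ T.extFaces := by
      simp only [intFaces, extFaces, Finset.mem_filter, Finset.mem_univ, true_and,
        not_not] at hσ ⊢
      exact hσ
    have h0 : T.faceIntegral σ (u K) = 0 := hu.2 σ hext K hσK
    obtain ⟨y₀, hy₀⟩ := face_nonempty hd σ
    have hshift : ∀ y ∈ σ.1, inner ℝ (O.normal σ) (x - y) = inner ℝ (O.normal σ) (x - y₀) := by
      intro y hy
      rw [← sub_eq_zero, ← inner_sub_right, sub_sub_sub_cancel_left]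
      exact O.normal_orthogonal σ y₀ hy₀ y hy
    rcases (inner_normal_ne_zero O hσK hy₀ hx hxσ).lt_or_gt with h | h
    · refine ⟨O.normal σ, O.norm_normal σ, horth, fun y hy hyx => ?_, ?_⟩
      · rw [hshift y ((hKx y hy).1 hyx)]; exact h
      · rw [outFlux, if_neg hσ, h0, inner_zero_left]
    · refine ⟨-O.normal σ, by rw [norm_neg, O.norm_normal], fun y hy z hz hyx hzx => by
        rw [inner_neg_left, horth y hy z hz hyx hzx, neg_zero], fun y hy hyx => ?_, ?_⟩
      · rw [inner_neg_left, neg_lt_zero, hshift y ((hKx y hy).1 hyx)]; exact h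
      · rw [outFlux, if_neg hσ, h0, inner_zero_left]

open Classical in
-- The faces of an element correspond to its vertices by erasing one vertex, which turns the face
-- sum into the vertex sum of `divergence_simplex`.
lemma sum_outFlux_cell (hd : 0 < d) {O : T.Orientation} {u : T.PwAffine}
    (hu : u ∈ T.crouzeixRaviart₀ O) (K : T.Cell) :
    ∑ σ : T.Face, (if σ.1 ⊆ K.1 then outFlux O u K σ else 0)
      = volume.real (T.body K) * divg (u K) := by
  have hface : ∀ x ∈ K.1, K.1.erase x ∈ T.faces := fun x hx => by
    refine Finset.mem_biUnion.2 ⟨K.1, K.2, Finset.mem_powersetCard.2 ⟨Finset.erase_subset _ _, ?_⟩⟩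
    rw [Finset.card_erase_of_mem hx, T.card_eq _ K.2]; rfl
  let G : Pt d → ℝ := fun x => if h : x ∈ K.1 then outFlux O u K ⟨K.1.erase x, hface x h⟩ else 0
  have hdiv := divergence_simplex hd K.1 (T.indep _ K.2) (card_cell K) (u K) G (by
    intro x hx
    have h := exists_outward_normal hd hu (σ := ⟨K.1.erase x, hface x hx⟩)
      (Finset.erase_subset _ _) hx (fun y hy => by simp [hy])
    simp only [G, dif_pos hx]
    exact h)
  rw [body, ← hdiv, ← Finset.sum_filter]
  symm
  refine Finset.sum_bij (fun x hx => ⟨K.1.erase x, hface x hx⟩) ?_ ?_ ?_ ?_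
  · intro x hx
    simp [Finset.erase_subset]
  · intro x hx y hy h
    exact Finset.erase_injOn K.1 hx hy (congrArg Subtype.val h)
  · intro σ hσ
    obtain ⟨x, hx, hxσ, hKx⟩ := exists_opposite_vertex (Finset.mem_filter.1 hσ).2
    refine ⟨x, hx, Subtype.ext (Finset.ext fun y => ?_)⟩
    have hsub := (Finset.mem_filter.1 hσ).2
    rw [Finset.mem_erase]
    exact ⟨fun h => (hKx y h.2).1 h.1, fun h => ⟨(hKx y (hsub h)).2 h, hsub h⟩⟩
  · intro x hx
    simp only [G, dif_pos hx]

/-- Summation by parts for the divergence of a Crouzeix-Raviart field with zero boundary means. -/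
lemma sum_volume_mul_divg (hd : 0 < d) {O : T.Orientation} {u : T.PwAffine}
    (hu : u ∈ T.crouzeixRaviart₀ O) (p : T.PwConst) :
    ∑ K : T.Cell, volume.real (T.body K) * (p K * divg (u K))
      = -∑ σ ∈ T.intFaces, T.faceArea σ * (T.faceVel O u σ * jump O p σ) := by
  classical
  have h1 : ∀ K : T.Cell, volume.real (T.body K) * (p K * divg (u K))
      = ∑ σ : T.Face, (if σ.1 ⊆ K.1 then p K * outFlux O u K σ else 0) := by
    intro K
    rw [mul_left_comm, ← sum_outFlux_cell hd hu, Finset.mul_sum]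
    refine Finset.sum_congr rfl fun σ _ => ?_
    rw [mul_ite, mul_zero]
  rw [Finset.sum_congr rfl fun K _ => h1 K, Finset.sum_comm, ← Finset.sum_neg_distrib]
  have h2 : ∀ σ : T.Face, σ ∉ T.intFaces →
      ∑ K : T.Cell, (if σ.1 ⊆ K.1 then p K * outFlux O u K σ else 0) = 0 := by
    intro σ hσ
    refine Finset.sum_eq_zero fun K _ => ?_
    simp [outFlux, hσ]
  rw [← Finset.sum_subset (Finset.subset_univ T.intFaces) fun σ _ hσ => h2 σ hσ]
  refine Finset.sum_congr rfl fun σ hσ => ?_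
  have hne := inn_ne_out hd O hσ
  -- Only the two neighbours contribute, with opposite signs of the same flux; their sum is the jump
  -- of `p`.
  rw [← Finset.sum_subset (Finset.subset_univ {O.inn σ, O.out σ}), Finset.sum_pair hne,
    if_pos (O.subset_inn σ), if_pos (O.subset_out σ hσ), outFlux, outFlux, if_pos hσ, if_pos hσ,
    if_pos rfl, if_neg hne.symm, jump]
  · ring
  · intro K _ hK
    rw [if_neg]
    intro hsub
    apply hK
    rcases eq_inn_or_eq_out hd O hσ hsub with h | h <;> simp [h]

end Triangulation

/-! ### Pointwise identities -/

section Pointwise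

variable {V : Type*} [NormedAddCommGroup V] [InnerProductSpace ℝ V]

/-- The jump of half the squared norm is the average of `a` and `b` paired with `b - a`. Subtracting
thus replaces the upwind value by its deviation from the average, which is half the jump against the
flow, while the diffusive part collapses to the mean density times the jump. -/
lemma kinetic_flux_identity (a b : V) (ri ro s e : ℝ) :
    inner ℝ (((s + |s|) / 2) • (ri • a) + ((s - |s|) / 2) • (ro • b) - e • (ro • b - ri • a)) (b - a)
      - (((s + |s|) / 2) • ri + ((s - |s|) / 2) • ro - e • (ro - ri))
        * (‖b‖ ^ 2 / 2 - ‖a‖ ^ 2 / 2)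
      = -(((if 0 ≤ s then ri else ro) * (|s| / 2) + e * ((ro + ri) / 2)) * ‖b - a‖ ^ 2) := by
  rw [norm_sub_sq_real]
  simp only [inner_sub_left, inner_add_left, inner_sub_right, inner_smul_left, conj_trivial,
    real_inner_self_eq_norm_sq, smul_eq_mul]
  rw [real_inner_comm a b]
  split_ifs with h
  · rw [abs_of_nonneg h]; ring
  · rw [abs_of_neg (not_le.1 h)]; ring

/-- After the continuity part is subtracted, the mixed term carries only the old density `r'`;
completing the square therefore weights the dissipation by `r'`. -/
lemma kinetic_time_identity (P : Params) (a' a : V) (r' r : ℝ) :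
    inner ℝ (P.Dt (r' • a') (r • a)) a - P.Dt r' r * (‖a‖ ^ 2 / 2)
      = P.dt⁻¹ * (1 / 2 * r * ‖a‖ ^ 2 - 1 / 2 * r' * ‖a'‖ ^ 2)
        + P.dt / 2 * (r' * ‖P.Dt a' a‖ ^ 2) := by
  have hdt := P.dt_pos.ne'
  have h : ‖P.Dt a' a‖ ^ 2 = P.dt⁻¹ ^ 2 * ‖a - a'‖ ^ 2 := by
    rw [Params.Dt, norm_smul, mul_pow, Real.norm_eq_abs, sq_abs]
  rw [h, norm_sub_sq_real]
  simp only [Params.Dt, inner_sub_left, inner_smul_left, conj_trivial,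
    real_inner_self_eq_norm_sq, smul_eq_mul]
  rw [real_inner_comm a a']
  field_simp
  ring

lemma magnetic_time_identity (P : Params) (b' b : V) :
    inner ℝ (P.Dt b' b) b
      = P.dt⁻¹ * (1 / 2 * ‖b‖ ^ 2) + -P.dt⁻¹ * (1 / 2 * ‖b'‖ ^ 2)
        + P.dt / 2 * ‖P.Dt b' b‖ ^ 2 := by
  have hdt := P.dt_pos.ne'
  have h : ‖P.Dt b' b‖ ^ 2 = P.dt⁻¹ ^ 2 * ‖b - b'‖ ^ 2 := by
    rw [Params.Dt, norm_smul, mul_pow, Real.norm_eq_abs, sq_abs]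
  rw [h, norm_sub_sq_real]
  simp only [Params.Dt, inner_sub_left, inner_smul_left, conj_trivial,
    real_inner_self_eq_norm_sq]
  rw [real_inner_comm b b']
  field_simp
  ring

end Pointwise

/-! ### Mean value theorems -/

lemma add_mul_sub_mem_uIcc (x y : ℝ) {t : ℝ} (ht : t ∈ Set.Icc (0 : ℝ) 1) :
    x + t * (y - x) ∈ Set.uIcc x y := by
  rw [← segment_eq_uIcc]
  exact ⟨1 - t, t, by linarith [ht.2], ht.1, by ring, by simp only [smul_eq_mul]; ring⟩

/-- Parametrising the segment by the unit interval treats both orders of the endpoints, and their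
coincidence, at once. -/
lemma exists_mean_value_uIcc {f f' : ℝ → ℝ} {x y : ℝ}
    (hf : ∀ z ∈ Set.uIcc x y, HasDerivAt f (f' z) z) :
    ∃ z ∈ Set.uIcc x y, f y - f x = f' z * (y - x) := by
  have hline : ∀ t : ℝ, HasDerivAt (fun t => x + t * (y - x)) (y - x) t := fun t => by
    simpa using ((hasDerivAt_id t).mul_const (y - x)).const_add x
  have hg : ∀ t ∈ Set.Icc (0 : ℝ) 1, HasDerivAt (fun t => f (x + t * (y - x)))
      (f' (x + t * (y - x)) * (y - x)) t := fun t ht =>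
    (hf _ (add_mul_sub_mem_uIcc x y ht)).comp t (hline t)
  obtain ⟨c, hc, h⟩ := exists_hasDerivAt_eq_slope _ _ zero_lt_one
    (fun t ht => (hg t ht).continuousAt.continuousWithinAt)
    (fun t ht => hg t (Set.Ioo_subset_Icc_self ht))
  refine ⟨_, add_mul_sub_mem_uIcc x y (Set.Ioo_subset_Icc_self hc), ?_⟩
  rw [h]; simp

/-- Taylor's formula of order two with Lagrange remainder, for either order of the points. -/
lemma exists_taylor_two_uIcc {f f' f'' : ℝ → ℝ} {x y : ℝ}
    (hf : ∀ z ∈ Set.uIcc x y, HasDerivAt f (f' z) z)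
    (hf' : ∀ z ∈ Set.uIcc x y, HasDerivAt f' (f'' z) z) :
    ∃ z ∈ Set.uIcc x y, f y = f x + f' x * (y - x) + f'' z / 2 * (y - x) ^ 2 := by
  have hline : ∀ t : ℝ, HasDerivAt (fun t => x + t * (y - x)) (y - x) t := fun t => by
    simpa using ((hasDerivAt_id t).mul_const (y - x)).const_add x
  have hg : ∀ t ∈ Set.Icc (0 : ℝ) 1,
      HasDerivAt (fun t => f (x + t * (y - x)) - t * (f' x * (y - x)))
        (f' (x + t * (y - x)) * (y - x) - f' x * (y - x)) t := fun t ht =>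
    ((hf _ (add_mul_sub_mem_uIcc x y ht)).comp t (hline t)).sub
      (by simpa using (hasDerivAt_id t).mul_const (f' x * (y - x)))
  have hsq : ∀ t : ℝ, HasDerivAt (fun t : ℝ => t ^ 2) (2 * t) t := fun t => by
    simpa using hasDerivAt_pow 2 t
  -- Cauchy's mean value theorem against `t ^ 2` leaves an increment of `f'`, to which the ordinary
  -- mean value theorem applies.
  obtain ⟨c, hc, h⟩ := exists_ratio_hasDerivAt_eq_ratio_slope _ _ zero_lt_one
    (fun t ht => (hg t ht).continuousAt.continuousWithinAt)
    (fun t ht => hg t (Set.Ioo_subset_Icc_self ht)) _ _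
    (fun t _ => (hsq t).continuousAt.continuousWithinAt) (fun t _ => hsq t)
  have hcm := add_mul_sub_mem_uIcc x y (Set.Ioo_subset_Icc_self hc)
  have hsub : Set.uIcc x (x + c * (y - x)) ⊆ Set.uIcc x y :=
    Set.uIcc_subset_uIcc Set.left_mem_uIcc hcm
  obtain ⟨z, hz, hmv⟩ := exists_mean_value_uIcc fun w hw => hf' w (hsub hw)
  refine ⟨z, hsub hz, ?_⟩
  have hc0 : c ≠ 0 := hc.1.ne'
  have h2 : f' (x + c * (y - x)) = f' x + f'' z * (c * (y - x)) := by
    rw [← sub_eq_iff_eq_add', hmv]; ring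
  rw [h2] at h
  simp only [one_mul, zero_mul, add_zero, add_sub_cancel] at h
  have h3 : c * (2 * (f y - f' x * (y - x) - f x)) = c * (f'' z * (y - x) ^ 2) := by
    linear_combination -h
  have h4 := mul_left_cancel₀ hc0 h3
  linear_combination h4 / 2

/-- A weighted mean of two values of a continuous function is again a value, by the intermediate
value theorem. This merges the intermediate points of the diffusive and the upwind part into a
single ζ. -/
lemma exists_weighted_mean_uIcc {g : ℝ → ℝ} {x y z w A B : ℝ} (hg : ContinuousOn g (Set.uIcc x y))
    (hz : z ∈ Set.uIcc x y) (hw : w ∈ Set.uIcc x y) (hA : 0 ≤ A) (hB : 0 ≤ B) :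
    ∃ q ∈ Set.uIcc x y, A * g z + B * g w = (A + B) * g q := by
  rcases (add_nonneg hA hB).eq_or_lt with h0 | hpos
  · have hA0 : A = 0 := by linarith
    have hB0 : B = 0 := by linarith
    exact ⟨z, hz, by simp [hA0, hB0]⟩
  have hsub : Set.uIcc z w ⊆ Set.uIcc x y := Set.uIcc_subset_uIcc hz hw
  have hmem : A / (A + B) * g z + B / (A + B) * g w ∈ Set.uIcc (g z) (g w) := by
    rw [← segment_eq_uIcc]
    exact ⟨A / (A + B), B / (A + B), by positivity, by positivity, by field_simp, rfl⟩
  obtain ⟨q, hq, hgq⟩ := intermediate_value_uIcc (hg.mono hsub) hmem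
  refine ⟨q, hsub hq, ?_⟩
  rw [hgq]; field_simp

/-! ### The pressure potential -/

namespace Params

variable (P : Params)

/-- The first derivative of the pressure potential. -/
noncomputable def potential' (r : ℝ) : ℝ := P.a * P.gamma / (P.gamma - 1) * r ^ (P.gamma - 1)

lemma gamma_sub_one_pos : 0 < P.gamma - 1 := sub_pos.2 P.one_lt_gamma

lemma hasDerivAt_potential (r : ℝ) : HasDerivAt P.potential (P.potential' r) r := by
  have h := (Real.hasDerivAt_rpow_const (x := r) (Or.inr P.one_lt_gamma.le)).const_mul
    (P.a / (P.gamma - 1))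
  refine h.congr_deriv ?_
  rw [potential']; ring

lemma hasDerivAt_potential'_explicit {r : ℝ} (hr : 0 < r) :
    HasDerivAt P.potential' (P.a * P.gamma * r ^ (P.gamma - 2)) r := by
  have h := (Real.hasDerivAt_rpow_const (x := r) (p := P.gamma - 1) (Or.inl hr.ne')).const_mul
    (P.a * P.gamma / (P.gamma - 1))
  refine h.congr_deriv ?_
  have := P.gamma_sub_one_pos.ne'
  rw [show P.gamma - 1 - 1 = P.gamma - 2 by ring]
  field_simp

lemma potential''_eq {r : ℝ} (hr : 0 < r) :
    P.potential'' r = P.a * P.gamma * r ^ (P.gamma - 2) := by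
  rw [potential'', iteratedDeriv_succ, iteratedDeriv_one,
    show deriv P.potential = P.potential' from funext fun x => (P.hasDerivAt_potential x).deriv]
  exact (P.hasDerivAt_potential'_explicit hr).deriv

lemma hasDerivAt_potential' {r : ℝ} (hr : 0 < r) :
    HasDerivAt P.potential' (P.potential'' r) r := by
  rw [P.potential''_eq hr]; exact P.hasDerivAt_potential'_explicit hr

lemma potential''_nonneg {r : ℝ} (hr : 0 < r) : 0 ≤ P.potential'' r := by
  rw [P.potential''_eq hr]
  have := P.a_pos
  have : 0 < P.gamma := by linarith [P.one_lt_gamma]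
  positivity

/-- The thermodynamic relation that lets the continuity equation, tested with `P.potential'`,
produce the pressure. -/
lemma mul_potential' {r : ℝ} (hr : 0 < r) : r * P.potential' r = P.pressure r + P.potential r := by
  have h : r ^ P.gamma = r * r ^ (P.gamma - 1) := by
    rw [Real.rpow_sub_one hr.ne']; field_simp
  have := P.gamma_sub_one_pos.ne'
  rw [potential', pressure, potential, h]
  field_simp
  ring

lemma pos_of_mem_uIcc {x y z : ℝ} (hx : 0 < x) (hy : 0 < y) (hz : z ∈ Set.uIcc x y) : 0 < z :=
  (lt_min hx hy).trans_le hz.1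

lemma continuousOn_potential'' {x y : ℝ} (hx : 0 < x) (hy : 0 < y) :
    ContinuousOn P.potential'' (Set.uIcc x y) := by
  have h : ContinuousOn (fun r : ℝ => P.a * P.gamma * r ^ (P.gamma - 2)) (Set.uIcc x y) :=
    continuousOn_const.mul (continuousOn_id.rpow_const fun z hz =>
      Or.inl (pos_of_mem_uIcc hx hy hz).ne')
  exact h.congr fun z hz => P.potential''_eq (pos_of_mem_uIcc hx hy hz)

lemma exists_taylor_potential {x y : ℝ} (hx : 0 < x) (hy : 0 < y) :
    ∃ z ∈ Set.uIcc x y, P.potential y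
      = P.potential x + P.potential' x * (y - x) + P.potential'' z / 2 * (y - x) ^ 2 :=
  exists_taylor_two_uIcc (fun z _ => P.hasDerivAt_potential z)
    fun _ hz => P.hasDerivAt_potential' (pos_of_mem_uIcc hx hy hz)

/-- The expansion is taken around the new value `r`, where backward Euler evaluates the derivative;
convexity then makes the remainder dissipative. -/
lemma internal_time_identity {r' r : ℝ} (hr' : 0 < r') (hr : 0 < r) :
    ∃ ξ ∈ Set.uIcc r' r, P.Dt r' r * P.potential' r
      = P.dt⁻¹ * (P.potential r - P.potential r')
        + P.dt / 2 * (P.potential'' ξ * |P.Dt r' r| ^ 2) := by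
  obtain ⟨ξ, hξ, h⟩ := P.exists_taylor_potential hr hr'
  refine ⟨ξ, Set.uIcc_comm r r' ▸ hξ, ?_⟩
  have hdt := P.dt_pos.ne'
  rw [sq_abs, h]
  simp only [Dt, smul_eq_mul]
  field_simp
  ring

lemma internal_flux_identity {i o : ℝ} (hi : 0 < i) (ho : 0 < o) (s : ℝ) {e : ℝ} (he : 0 ≤ e) :
    ∃ ζ ∈ Set.uIcc i o,
      (((s + |s|) / 2) • i + ((s - |s|) / 2) • o - e • (o - i)) * (P.potential' o - P.potential' i)
        = s * (P.pressure o - P.pressure i)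
          - P.potential'' ζ * (o - i) ^ 2 * (e + |s| / 2) := by
  obtain ⟨z, hz, hmv⟩ := exists_mean_value_uIcc (x := i) (y := o)
    fun w hw => P.hasDerivAt_potential' (pos_of_mem_uIcc hi ho hw)
  have hmi := P.mul_potential' hi
  have hmo := P.mul_potential' ho
  obtain ⟨w, hw, hup⟩ : ∃ w ∈ Set.uIcc i o,
      (((s + |s|) / 2) * i + ((s - |s|) / 2) * o) * (P.potential' o - P.potential' i)
        = s * (P.pressure o - P.pressure i) - P.potential'' w * (o - i) ^ 2 * (|s| / 2) := by
    -- The Taylor expansion is centred at the downwind value, where the derivative meets the upwind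
    -- density; `mul_potential'` at both ends turns the rest into the pressure jump.
    rcases le_or_gt 0 s with hs | hs
    · obtain ⟨w, hw, h⟩ := P.exists_taylor_potential ho hi
      refine ⟨w, Set.uIcc_comm o i ▸ hw, ?_⟩
      rw [abs_of_nonneg hs]
      linear_combination s * hmo - s * hmi - s * h
    · obtain ⟨w, hw, h⟩ := P.exists_taylor_potential hi ho
      refine ⟨w, hw, ?_⟩
      rw [abs_of_neg hs]
      linear_combination s * hmo - s * hmi + s * h
  obtain ⟨q, hq, h⟩ := exists_weighted_mean_uIcc (P.continuousOn_potential'' hi ho) hz hw he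
    (by positivity : 0 ≤ |s| / 2)
  refine ⟨q, hq, ?_⟩
  simp only [smul_eq_mul]
  linear_combination hup - e * (o - i) * hmv - (o - i) ^ 2 * h

end Params

namespace Triangulation

variable {d : ℕ} {Ω : Set (Pt d)} {T : Triangulation d Ω}

/-! ### Integration over elements -/

lemma isCompact_body (K : T.Cell) : IsCompact (T.body K) :=
  K.1.finite_toSet.isCompact_convexHull ℝ

lemma interior_body_nonempty (K : T.Cell) : (interior (T.body K)).Nonempty := by
  rw [body, ← range_simplexBasis K.1 (T.indep _ K.2) (card_cell K)]
  exact ⟨_, (simplexBasis K.1 (T.indep _ K.2) (card_cell K)).centroid_mem_interior_convexHull⟩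

lemma volume_body_ne_zero (K : T.Cell) : volume (T.body K) ≠ 0 :=
  (Measure.measure_pos_of_nonempty_interior _ (interior_body_nonempty K)).ne'

lemma volume_real_body_pos (K : T.Cell) : 0 < volume.real (T.body K) :=
  ENNReal.toReal_pos (volume_body_ne_zero K) (isCompact_body K).measure_lt_top.ne

lemma integral_const (c : T.Cell → ℝ) :
    T.integral (fun K _ => c K) = ∑ K : T.Cell, volume.real (T.body K) * c K := by
  simp [integral, measureReal_def]

lemma integral_add {f g : T.Cell → Pt d → ℝ} (hf : ∀ K, Continuous (f K))
    (hg : ∀ K, Continuous (g K)) :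
    T.integral (fun K x => f K x + g K x) = T.integral f + T.integral g := by
  rw [integral, integral, integral, ← Finset.sum_add_distrib]
  refine Finset.sum_congr rfl fun K _ => ?_
  exact MeasureTheory.integral_add ((hf K).continuousOn.integrableOn_compact (isCompact_body K))
    ((hg K).continuousOn.integrableOn_compact (isCompact_body K))

lemma integral_const_mul (c : ℝ) (f : T.Cell → Pt d → ℝ) :
    T.integral (fun K x => c * f K x) = c * T.integral f := by
  rw [integral, integral, Finset.mul_sum]
  exact Finset.sum_congr rfl fun K _ => MeasureTheory.integral_const_mul _ _

/-- Against a constant on each cell only the cell mean of the field is seen, so the time derivative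
in the momentum equation is effectively tested with cell means. -/
lemma integral_inner_const (c : T.Cell → Pt d) (v : T.PwAffine) :
    T.integral (fun K x => inner ℝ (c K) (v K x))
      = ∑ K : T.Cell, volume.real (T.body K) * inner ℝ (c K) (T.cellMean v K) := by
  refine Finset.sum_congr rfl fun K _ => ?_
  have hint : IntegrableOn (v K) (T.body K) :=
    (v K).continuous_of_finiteDimensional.continuousOn.integrableOn_compact (isCompact_body K)
  rw [integral_inner hint, cellMean, setAverage_eq, inner_smul_right, ← mul_assoc,
    mul_inv_cancel₀ (volume_real_body_pos K).ne', one_mul]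

lemma size_nonneg : 0 ≤ T.size := Real.iSup_nonneg fun _ => Metric.diam_nonneg

lemma size_rpow_nonneg (e : ℝ) : 0 ≤ T.size ^ e := Real.rpow_nonneg size_nonneg e

lemma faceArea_nonneg (σ : T.Face) : 0 ≤ T.faceArea σ := measureReal_nonneg

/-! ### Positivity of the density -/

/-- An element is only known to have its interior inside `Ω`. This suffices because the frontier of
a convex set is null. -/
lemma average_pos {ρ₀ : Pt d → ℝ} (hint : IntegrableOn ρ₀ Ω volume)
    (hpos : ∀ᵐ x ∂(volume.restrict Ω), 0 < ρ₀ x) (K : T.Cell) : 0 < ⨍ x in T.body K, ρ₀ x := by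
  have hconv : Convex ℝ (T.body K) := convex_convexHull ℝ _
  have hae : (interior (T.body K) : Set (Pt d)) =ᵐ[volume] T.body K :=
    interior_ae_eq_of_null_frontier (hconv.addHaar_frontier volume)
  have hsub : interior (T.body K) ⊆ Ω := T.interior_subset K.1 K.2
  have hres : volume.restrict (T.body K) = volume.restrict (interior (T.body K)) :=
    (Measure.restrict_congr_set hae).symm
  rw [setAverage_eq, hres, smul_eq_mul]
  refine mul_pos (inv_pos.2 (volume_real_body_pos K)) ?_
  have hpos' : ∀ᵐ x ∂(volume.restrict (interior (T.body K))), 0 < ρ₀ x :=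
    ae_restrict_of_ae_restrict_of_subset hsub hpos
  rw [integral_pos_iff_support_of_nonneg_ae (hpos'.mono fun x hx => hx.le) (hint.mono_set hsub)]
  have hsupp : (Function.support ρ₀ : Set (Pt d))
      =ᵐ[volume.restrict (interior (T.body K))] Set.univ := by
    filter_upwards [hpos'] with x hx
    exact propext ⟨fun _ => trivial, fun _ => hx.ne'⟩
  rw [measure_congr hsupp, Measure.restrict_apply_univ]
  exact isOpen_interior.measure_pos _ (interior_body_nonempty K)

lemma continuityEq_iff (O : T.Orientation) (P : Params) (ρ' ρ : T.PwConst) (u : T.PwAffine) :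
    T.ContinuityEq O P ρ' ρ u ↔ ∀ φ : T.PwConst,
      ∑ K : T.Cell, volume.real (T.body K) * (P.Dt (ρ' K) (ρ K) * φ K)
        - ∑ σ ∈ T.intFaces, T.faceArea σ * (T.flux O P.eps ρ u σ * jump O φ σ) = 0 := by
  simp only [ContinuityEq, integral_const, faceIntegral_const]

/-- The implicit upwind scheme preserves positivity of the density. -/
lemma density_pos {O : T.Orientation} {P : Params} {ρ' ρ : T.PwConst} {u : T.PwAffine}
    (h : T.ContinuityEq O P ρ' ρ u) (hρ' : ∀ K, 0 < ρ' K) (K : T.Cell) : 0 < ρ K := by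
  by_contra hK
  -- Testing with the indicator of the set where `ρ` is nonpositive: upwinding and diffusion make
  -- the face sum nonnegative, whereas a single such cell makes the time term strictly negative.
  have hφ := (continuityEq_iff O P ρ' ρ u).1 h fun K => if ρ K ≤ 0 then 1 else 0
  have hflux : 0 ≤ ∑ σ ∈ T.intFaces, T.faceArea σ * (T.flux O P.eps ρ u σ *
      jump O (fun K => if ρ K ≤ 0 then (1 : ℝ) else 0) σ) := by
    refine Finset.sum_nonneg fun σ _ => mul_nonneg (faceArea_nonneg σ) ?_
    have he := size_rpow_nonneg (T := T) P.eps
    have h1 : 0 ≤ (T.faceVel O u σ + |T.faceVel O u σ|) / 2 := by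
      linarith [neg_abs_le (T.faceVel O u σ)]
    have h2 : (T.faceVel O u σ - |T.faceVel O u σ|) / 2 ≤ 0 := by
      linarith [le_abs_self (T.faceVel O u σ)]
    simp only [flux, jump, smul_eq_mul]
    by_cases hi : ρ (O.inn σ) ≤ 0 <;> by_cases ho : ρ (O.out σ) ≤ 0
    · simp [hi, ho]
    · simp only [hi, ho, if_true, if_false]
      have h3 := mul_nonpos_of_nonneg_of_nonpos h1 hi
      have h4 := mul_nonpos_of_nonpos_of_nonneg h2 (not_le.1 ho).le
      have h5 := mul_nonneg he (by linarith : 0 ≤ ρ (O.out σ) - ρ (O.inn σ))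
      linarith
    · simp only [hi, ho, if_true, if_false]
      have h3 := mul_nonneg h1 (not_le.1 hi).le
      have h4 := mul_nonneg_of_nonpos_of_nonpos h2 ho
      have h5 := mul_nonpos_of_nonneg_of_nonpos he
        (by linarith : ρ (O.out σ) - ρ (O.inn σ) ≤ 0)
      linarith
    · simp [hi, ho]
  have hcell : ∑ K : T.Cell, volume.real (T.body K) *
      (P.Dt (ρ' K) (ρ K) * if ρ K ≤ 0 then (1 : ℝ) else 0) < 0 := by
    have hneg : ∀ L : T.Cell, ρ L ≤ 0 → P.Dt (ρ' L) (ρ L) < 0 := fun L hL =>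
      mul_neg_of_pos_of_neg (inv_pos.2 P.dt_pos) (by linarith [hρ' L])
    refine Finset.sum_neg' (fun L _ => ?_) ⟨K, Finset.mem_univ K, ?_⟩
    · refine mul_nonpos_of_nonneg_of_nonpos (volume_real_body_pos L).le ?_
      split_ifs with hL
      · rw [mul_one]; exact (hneg L hL).le
      · rw [mul_zero]
    · rw [if_pos (not_lt.1 hK), mul_one]
      exact mul_neg_of_pos_of_neg (volume_real_body_pos K) (hneg K (not_lt.1 hK))
  linarith

lemma IsSolution.density_pos {O : T.Orientation} {P : Params} {N : ℕ} {ρ₀ : Pt d → ℝ}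
    {ρ : ℕ → T.PwConst} {u B : ℕ → T.PwAffine} (h : T.IsSolution O P N ρ₀ ρ u B)
    (hint : IntegrableOn ρ₀ Ω volume) (hpos : ∀ᵐ x ∂(volume.restrict Ω), 0 < ρ₀ x) :
    ∀ k ≤ N, ∀ K, 0 < ρ k K := by
  intro k
  induction k with
  | zero => intro _ K; rw [h.init_density]; exact average_pos hint hpos K
  | succ k ih =>
    intro hk
    exact Triangulation.density_pos (h.continuity k (by omega)) (ih (by omega))

/-! ### Balance of the kinetic, internal and magnetic energy -/

/-- The work of the Lorentz force. -/
noncomputable def lorentzWork (T : Triangulation d Ω) (u B' B : T.PwAffine) : ℝ :=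
  T.integral fun K x => crossProduct (curl (B K)) (toR3 (B' K x)) ⬝ᵥ toR3 (u K x)

/-- The magnetic energy. -/
noncomputable def magneticEnergy (T : Triangulation d Ω) (B : T.PwAffine) : ℝ :=
  T.integral fun K x => 1 / 2 * ‖B K x‖ ^ 2

lemma continuous_toR3 : Continuous (toR3 (d := d)) := by
  refine continuous_pi fun i => ?_
  unfold toR3
  split_ifs <;> fun_prop

lemma energy_eq (P : Params) (ρ : T.PwConst) (u B : T.PwAffine) :
    T.energy P ρ u B = ∑ K : T.Cell, volume.real (T.body K) * (1 / 2 * ρ K * ‖T.cellMean u K‖ ^ 2)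
      + ∑ K : T.Cell, volume.real (T.body K) * P.potential (ρ K) + T.magneticEnergy B := by
  have hB : ∀ K, Continuous fun x => 1 / 2 * ‖B K x‖ ^ 2 := fun K => by
    have := (B K).continuous_of_finiteDimensional
    fun_prop
  rw [energy, integral_add (fun K => continuous_const) hB,
    integral_const fun K => 1 / 2 * ρ K * ‖T.cellMean u K‖ ^ 2 + P.potential (ρ K),
    magneticEnergy, ← Finset.sum_add_distrib]
  simp only [mul_add]

/-- Antisymmetry of the triple product: the induction term of the Maxwell equation is minus the work
of the Lorentz force, so the two cancel. -/
lemma cross_dot_swap (u b c : Fin 3 → ℝ) :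
    crossProduct u b ⬝ᵥ c = -(crossProduct c b ⬝ᵥ u) := by
  simp [cross_apply, dotProduct, Fin.sum_univ_three]
  ring

/-- The test function is `B` itself, so only the new field has to satisfy the boundary condition;
`B'` may be any piecewise affine field. -/
lemma magnetic_balance {O : T.Orientation} {P : Params} {u B' B : T.PwAffine}
    (hB : B ∈ T.nedelec₀ O) (h : T.MaxwellEq O P u B' B) :
    P.dt⁻¹ * (T.magneticEnergy B - T.magneticEnergy B') + T.timeDissMagnetic P B' B
      + P.alpha * T.integral (fun K _ => curl (B K) ⬝ᵥ curl (B K)) + T.lorentzWork u B' B = 0 := by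
  have h := h B hB
  have hc : ∀ (v : T.PwAffine) K, Continuous (v K) := fun v K =>
    (v K).continuous_of_finiteDimensional
  have hcB := hc B
  have hcB' := hc B'
  have hcu := hc u
  have hc3 := continuous_toR3 (d := d)
  have hDt : ∀ K, Continuous fun x => P.Dt (B' K x) (B K x) := fun K => by
    have := hcB K
    have := hcB' K
    unfold Params.Dt
    fun_prop
  have hL : ∀ K, Continuous fun x => crossProduct (curl (B K)) (toR3 (B' K x)) ⬝ᵥ toR3 (u K x) := by
    intro K
    have h1 := hc3.comp (hcB' K)
    have h2 := hc3.comp (hcu K)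
    have h3 : Continuous fun y : Fin 3 → ℝ => crossProduct (curl (B K)) y :=
      LinearMap.continuous_of_finiteDimensional _
    exact (h3.comp h1).dotProduct h2
  have hpt : ∀ K x, inner ℝ (P.Dt (B' K x) (B K x)) (B K x)
      + P.alpha * (curl (B K) ⬝ᵥ curl (B K))
      - crossProduct (toR3 (u K x)) (toR3 (B' K x)) ⬝ᵥ curl (B K)
      = P.dt⁻¹ * (1 / 2 * ‖B K x‖ ^ 2) + -P.dt⁻¹ * (1 / 2 * ‖B' K x‖ ^ 2)
        + P.dt / 2 * ‖P.Dt (B' K x) (B K x)‖ ^ 2 + P.alpha * (curl (B K) ⬝ᵥ curl (B K))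
        + crossProduct (curl (B K)) (toR3 (B' K x)) ⬝ᵥ toR3 (u K x) := by
    intro K x
    rw [magnetic_time_identity, cross_dot_swap (toR3 (u K x))]; ring
  simp only [hpt] at h
  have e1 : ∀ K, Continuous fun x => P.dt⁻¹ * (1 / 2 * ‖B K x‖ ^ 2) := fun K => by
    have := hcB K; fun_prop
  have e2 : ∀ K, Continuous fun x => -P.dt⁻¹ * (1 / 2 * ‖B' K x‖ ^ 2) := fun K => by
    have := hcB' K; fun_prop
  have e3 : ∀ K, Continuous fun x => P.dt / 2 * ‖P.Dt (B' K x) (B K x)‖ ^ 2 := fun K => by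
    have := hDt K; fun_prop
  have e4 : ∀ K, Continuous fun _ : Pt d => P.alpha * (curl (B K) ⬝ᵥ curl (B K)) :=
    fun K => continuous_const
  rw [integral_add (fun K => (((e1 K).fun_add (e2 K)).fun_add (e3 K)).fun_add (e4 K)) hL,
    integral_add (fun K => ((e1 K).fun_add (e2 K)).fun_add (e3 K)) e4,
    integral_add (fun K => (e1 K).fun_add (e2 K)) e3, integral_add e1 e2,
    integral_const_mul P.dt⁻¹ (fun K x => 1 / 2 * ‖B K x‖ ^ 2), integral_const_mul (-P.dt⁻¹),
    integral_const_mul (P.dt / 2),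
    integral_const_mul P.alpha (fun K _ => curl (B K) ⬝ᵥ curl (B K))] at h
  rw [magneticEnergy, magneticEnergy, timeDissMagnetic, lorentzWork]
  linear_combination h

lemma timeDissVelocity_eq (P : Params) (ρ' : T.PwConst) (u' u : T.PwAffine) :
    T.timeDissVelocity P ρ' u' u = P.dt / 2 * ∑ K : T.Cell, volume.real (T.body K) *
      (ρ' K * ‖P.Dt (T.cellMean u' K) (T.cellMean u K)‖ ^ 2) := by
  rw [timeDissVelocity, integral_const fun K => ρ' K * ‖P.Dt (T.cellMean u' K) (T.cellMean u K)‖ ^ 2]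

lemma jumpDissVelocity_eq (O : T.Orientation) (P : Params) (ρ : T.PwConst) (u : T.PwAffine) :
    T.jumpDissVelocity O P ρ u = ∑ σ ∈ T.intFaces, T.faceArea σ *
      ((T.upwind O ρ u σ * (|T.faceVel O u σ| / 2) + T.size ^ P.eps * avg O ρ σ)
        * ‖jump O (T.cellMean u) σ‖ ^ 2) := by
  simp only [jumpDissVelocity, faceIntegral_const]

lemma jumpDissDensity_eq (O : T.Orientation) (P : Params) (ζ : T.Face → ℝ) (ρ : T.PwConst)
    (u : T.PwAffine) :
    T.jumpDissDensity O P ζ ρ u = ∑ σ ∈ T.intFaces, T.faceArea σ *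
      (P.potential'' (ζ σ) * jump O ρ σ ^ 2 * (T.size ^ P.eps + |T.faceVel O u σ| / 2)) := by
  simp only [jumpDissDensity, faceIntegral_const]

lemma timeDissDensity_eq (P : Params) (ξ ρ' ρ : T.PwConst) :
    T.timeDissDensity P ξ ρ' ρ = P.dt / 2 * ∑ K : T.Cell, volume.real (T.body K) *
      (P.potential'' (ξ K) * |P.Dt (ρ' K) (ρ K)| ^ 2) := by
  rw [timeDissDensity, integral_const fun K => P.potential'' (ξ K) * |P.Dt (ρ' K) (ρ K)| ^ 2]

/-- Momentum tested with `u` minus continuity tested with half the squared cell mean. The work of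
the pressure and of the Lorentz force stay as source terms. -/
lemma kinetic_balance {O : T.Orientation} {P : Params} {ρ' ρ : T.PwConst} {u' u B' B : T.PwAffine}
    (hu : u ∈ T.crouzeixRaviart₀ O) (hc : T.ContinuityEq O P ρ' ρ u)
    (hm : T.MomentumEq O P ρ' ρ u' u B' B) :
    P.dt⁻¹ * (∑ K : T.Cell, volume.real (T.body K) * (1 / 2 * ρ K * ‖T.cellMean u K‖ ^ 2)
        - ∑ K : T.Cell, volume.real (T.body K) * (1 / 2 * ρ' K * ‖T.cellMean u' K‖ ^ 2))
      + T.timeDissVelocity P ρ' u' u + T.jumpDissVelocity O P ρ u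
      + P.mu * T.integral (fun K _ => gradInner (u K) (u K))
      + P.nu d * T.integral (fun K _ => divg (u K) ^ 2)
      - ∑ K : T.Cell, volume.real (T.body K) * (P.pressure (ρ K) * divg (u K))
      - T.lorentzWork u B' B = 0 := by
  have h1 := hm u hu
  have h2 := (continuityEq_iff O P ρ' ρ u).1 hc fun K => ‖T.cellMean u K‖ ^ 2 / 2
  rw [integral_inner_const fun K => P.Dt (ρ' K • T.cellMean u' K) (ρ K • T.cellMean u K),
    integral_const fun K => (P.nu d * divg (u K) - P.pressure (ρ K)) * divg (u K)] at h1
  simp only [faceIntegral_const] at h1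
  have hdiv : ∑ K : T.Cell, volume.real (T.body K) *
      ((P.nu d * divg (u K) - P.pressure (ρ K)) * divg (u K))
      = P.nu d * T.integral (fun K _ => divg (u K) ^ 2)
        - ∑ K : T.Cell, volume.real (T.body K) * (P.pressure (ρ K) * divg (u K)) := by
    rw [integral_const fun K => divg (u K) ^ 2, Finset.mul_sum, ← Finset.sum_sub_distrib]
    exact Finset.sum_congr rfl fun K _ => by ring
  have htime : ∑ K : T.Cell, volume.real (T.body K) *
        inner ℝ (P.Dt (ρ' K • T.cellMean u' K) (ρ K • T.cellMean u K)) (T.cellMean u K)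
      - ∑ K : T.Cell, volume.real (T.body K) *
        (P.Dt (ρ' K) (ρ K) * (‖T.cellMean u K‖ ^ 2 / 2))
      = P.dt⁻¹ * (∑ K : T.Cell, volume.real (T.body K) * (1 / 2 * ρ K * ‖T.cellMean u K‖ ^ 2)
        - ∑ K : T.Cell, volume.real (T.body K) * (1 / 2 * ρ' K * ‖T.cellMean u' K‖ ^ 2))
      + T.timeDissVelocity P ρ' u' u := by
    rw [timeDissVelocity_eq, ← Finset.sum_sub_distrib, ← Finset.sum_sub_distrib, Finset.mul_sum,
      Finset.mul_sum, ← Finset.sum_add_distrib]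
    refine Finset.sum_congr rfl fun K _ => ?_
    linear_combination volume.real (T.body K) *
      kinetic_time_identity P (T.cellMean u' K) (T.cellMean u K) (ρ' K) (ρ K)
  have hjump : ∑ σ ∈ T.intFaces, T.faceArea σ *
        inner ℝ (T.flux O P.eps (fun K => ρ K • T.cellMean u K) u σ) (jump O (T.cellMean u) σ)
      - ∑ σ ∈ T.intFaces, T.faceArea σ *
        (T.flux O P.eps ρ u σ * jump O (fun K => ‖T.cellMean u K‖ ^ 2 / 2) σ)
      = -T.jumpDissVelocity O P ρ u := by
    rw [jumpDissVelocity_eq, ← Finset.sum_sub_distrib, ← Finset.sum_neg_distrib]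
    refine Finset.sum_congr rfl fun σ _ => ?_
    have := kinetic_flux_identity (T.cellMean u (O.inn σ)) (T.cellMean u (O.out σ))
      (ρ (O.inn σ)) (ρ (O.out σ)) (T.faceVel O u σ) (T.size ^ P.eps)
    simp only [flux, jump, upwind, avg]
    linear_combination T.faceArea σ * this
  rw [hdiv] at h1
  rw [lorentzWork]
  linear_combination h1 - h2 - htime + hjump

/-- Continuity tested with `P.potential'` of the new density. The face fluxes leave a sum of
pressure jumps times normal velocities, which `sum_volume_mul_divg` turns into the pressure work. -/
lemma internal_balance (hd : 0 < d) {O : T.Orientation} {P : Params} {ρ' ρ : T.PwConst}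
    {u : T.PwAffine} (hu : u ∈ T.crouzeixRaviart₀ O) (hc : T.ContinuityEq O P ρ' ρ u)
    (hρ' : ∀ K, 0 < ρ' K) (hρ : ∀ K, 0 < ρ K) :
    ∃ (ξ : T.PwConst) (ζ : T.Face → ℝ), (∀ K, ξ K ∈ Set.uIcc (ρ' K) (ρ K)) ∧
      (∀ σ, ζ σ ∈ Set.uIcc (ρ (O.inn σ)) (ρ (O.out σ))) ∧
      P.dt⁻¹ * (∑ K : T.Cell, volume.real (T.body K) * P.potential (ρ K)
          - ∑ K : T.Cell, volume.real (T.body K) * P.potential (ρ' K))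
        + T.timeDissDensity P ξ ρ' ρ + T.jumpDissDensity O P ζ ρ u
        + ∑ K : T.Cell, volume.real (T.body K) * (P.pressure (ρ K) * divg (u K)) = 0 := by
  choose ξ hξ hξeq using fun K => P.internal_time_identity (hρ' K) (hρ K)
  choose ζ hζ hζeq using fun σ => P.internal_flux_identity (hρ (O.inn σ)) (hρ (O.out σ))
    (T.faceVel O u σ) (size_rpow_nonneg (T := T) P.eps)
  refine ⟨ξ, ζ, hξ, hζ, ?_⟩
  have h := (continuityEq_iff O P ρ' ρ u).1 hc fun K => P.potential' (ρ K)
  have htime : ∑ K : T.Cell, volume.real (T.body K) * (P.Dt (ρ' K) (ρ K) * P.potential' (ρ K))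
      = P.dt⁻¹ * (∑ K : T.Cell, volume.real (T.body K) * P.potential (ρ K)
          - ∑ K : T.Cell, volume.real (T.body K) * P.potential (ρ' K))
        + T.timeDissDensity P ξ ρ' ρ := by
    rw [timeDissDensity_eq, ← Finset.sum_sub_distrib, Finset.mul_sum, Finset.mul_sum,
      ← Finset.sum_add_distrib]
    refine Finset.sum_congr rfl fun K _ => ?_
    linear_combination volume.real (T.body K) * hξeq K
  have hjump : ∑ σ ∈ T.intFaces, T.faceArea σ *
        (T.flux O P.eps ρ u σ * jump O (fun K => P.potential' (ρ K)) σ)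
      = ∑ σ ∈ T.intFaces, T.faceArea σ *
          (T.faceVel O u σ * jump O (fun K => P.pressure (ρ K)) σ)
        - T.jumpDissDensity O P ζ ρ u := by
    rw [jumpDissDensity_eq, ← Finset.sum_sub_distrib]
    refine Finset.sum_congr rfl fun σ _ => ?_
    simp only [flux, jump]
    linear_combination T.faceArea σ * hζeq σ
  have hdiv := sum_volume_mul_divg hd hu fun K => P.pressure (ρ K)
  linear_combination h - htime + hjump + hdiv

/-! ### Signs -/

lemma integral_nonneg {f : T.Cell → Pt d → ℝ} (hf : ∀ K x, 0 ≤ f K x) : 0 ≤ T.integral f :=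
  Finset.sum_nonneg fun K _ => MeasureTheory.integral_nonneg (hf K)

lemma timeDissVelocity_nonneg (P : Params) {ρ' : T.PwConst} (hρ' : ∀ K, 0 < ρ' K)
    (u' u : T.PwAffine) : 0 ≤ T.timeDissVelocity P ρ' u' u :=
  mul_nonneg (by linarith [P.dt_pos])
    (integral_nonneg fun K _ => mul_nonneg (hρ' K).le (sq_nonneg _))

lemma timeDissMagnetic_nonneg (P : Params) (B' B : T.PwAffine) : 0 ≤ T.timeDissMagnetic P B' B :=
  mul_nonneg (by linarith [P.dt_pos]) (integral_nonneg fun _ _ => sq_nonneg _)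

lemma timeDissDensity_nonneg (P : Params) {ξ : T.PwConst} (hξ : ∀ K, 0 < ξ K) (ρ' ρ : T.PwConst) :
    0 ≤ T.timeDissDensity P ξ ρ' ρ :=
  mul_nonneg (by linarith [P.dt_pos])
    (integral_nonneg fun K _ => mul_nonneg (P.potential''_nonneg (hξ K)) (sq_nonneg _))

lemma jumpDissVelocity_nonneg (O : T.Orientation) (P : Params) {ρ : T.PwConst}
    (hρ : ∀ K, 0 < ρ K) (u : T.PwAffine) : 0 ≤ T.jumpDissVelocity O P ρ u := by
  rw [jumpDissVelocity_eq]
  refine Finset.sum_nonneg fun σ _ => mul_nonneg (faceArea_nonneg σ)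
    (mul_nonneg (add_nonneg (mul_nonneg ?_ (by positivity))
      (mul_nonneg (size_rpow_nonneg _) ?_)) (sq_nonneg _))
  · rw [upwind]; split_ifs <;> exact (hρ _).le
  · rw [avg]; linarith [hρ (O.out σ), hρ (O.inn σ)]

lemma jumpDissDensity_nonneg (O : T.Orientation) (P : Params) {ζ : T.Face → ℝ}
    (hζ : ∀ σ, 0 < ζ σ) (ρ : T.PwConst) (u : T.PwAffine) : 0 ≤ T.jumpDissDensity O P ζ ρ u := by
  rw [jumpDissDensity_eq]
  exact Finset.sum_nonneg fun σ _ => mul_nonneg (faceArea_nonneg σ)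
    (mul_nonneg (mul_nonneg (P.potential''_nonneg (hζ σ)) (sq_nonneg _))
      (add_nonneg (size_rpow_nonneg _) (by positivity)))

lemma physicalDissipation_nonneg (hd : 2 ≤ d) (P : Params) (u B : T.PwAffine) :
    0 ≤ T.physicalDissipation P u B := by
  -- Here the dimension enters: `(d - 2) / d` is nonnegative for `d ≥ 2`.
  have hnu : 0 ≤ P.nu d := by
    have h2 : (2 : ℝ) ≤ d := by exact_mod_cast hd
    exact add_nonneg (mul_nonneg (div_nonneg (by linarith) (by linarith)) P.mu_pos.le) P.lam_nonneg
  refine add_nonneg (add_nonneg (mul_nonneg P.mu_pos.le (integral_nonneg fun K _ => ?_))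
    (mul_nonneg hnu (integral_nonneg fun K _ => sq_nonneg _)))
    (mul_nonneg P.alpha_pos.le (integral_nonneg fun K _ => ?_))
  · exact Finset.sum_nonneg fun i _ => Finset.sum_nonneg fun j _ => mul_self_nonneg _
  · exact Finset.sum_nonneg fun i _ => mul_self_nonneg _

end Triangulation

end MHD

/-! ### The total energy balance -/

theorem mainTheorem4 (d : ℕ) (hd : d = 2 ∨ d = 3)
    (Ω : Set (MHD.Pt d)) (hΩ_open : IsOpen Ω) (hΩ_conn : IsConnected Ω)
    (hΩ_bdd : Bornology.IsBounded Ω)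
    (T : MHD.Triangulation d Ω) (O : T.Orientation) (P : MHD.Params) (N : ℕ)
    (ρ₀ : MHD.Pt d → ℝ) (hρ₀_int : IntegrableOn ρ₀ Ω volume)
    (hρ₀_pos : ∀ᵐ x ∂(volume.restrict Ω), 0 < ρ₀ x)
    (ρ : ℕ → T.PwConst) (u B : ℕ → T.PwAffine)
    (hsol : T.IsSolution O P N ρ₀ ρ u B) :
    ∀ k < N, ∃ (ξ : T.PwConst) (ζ : T.Face → ℝ),
      (∀ K : T.Cell, ξ K ∈ Set.uIcc (ρ k K) (ρ (k + 1) K)) ∧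
      (∀ σ ∈ T.intFaces, ζ σ ∈ Set.uIcc (ρ (k + 1) (O.inn σ)) (ρ (k + 1) (O.out σ))) ∧
      -- the discrete energy balance
      P.Dt (T.energy P (ρ k) (u k) (B k)) (T.energy P (ρ (k + 1)) (u (k + 1)) (B (k + 1)))
          + T.physicalDissipation P (u (k + 1)) (B (k + 1))
        = - T.timeDissVelocity P (ρ k) (u k) (u (k + 1))
          - T.timeDissMagnetic P (B k) (B (k + 1))
          - T.timeDissDensity P ξ (ρ k) (ρ (k + 1))
          - T.jumpDissVelocity O P (ρ (k + 1)) (u (k + 1))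
          - T.jumpDissDensity O P ζ (ρ (k + 1)) (u (k + 1)) ∧
      -- every term on its right-hand side is nonpositive
      0 ≤ T.timeDissVelocity P (ρ k) (u k) (u (k + 1)) ∧
      0 ≤ T.timeDissMagnetic P (B k) (B (k + 1)) ∧
      0 ≤ T.timeDissDensity P ξ (ρ k) (ρ (k + 1)) ∧
      0 ≤ T.jumpDissVelocity O P (ρ (k + 1)) (u (k + 1)) ∧
      0 ≤ T.jumpDissDensity O P ζ (ρ (k + 1)) (u (k + 1)) ∧
      -- and so is their sum, and the total energy does not increase
      - T.timeDissVelocity P (ρ k) (u k) (u (k + 1))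
          - T.timeDissMagnetic P (B k) (B (k + 1))
          - T.timeDissDensity P ξ (ρ k) (ρ (k + 1))
          - T.jumpDissVelocity O P (ρ (k + 1)) (u (k + 1))
          - T.jumpDissDensity O P ζ (ρ (k + 1)) (u (k + 1)) ≤ 0 ∧
      T.energy P (ρ (k + 1)) (u (k + 1)) (B (k + 1)) ≤ T.energy P (ρ k) (u k) (B k) := by
  intro k hk
  have hd2 : 2 ≤ d := by omega
  have hd0 : 0 < d := by omega
  have hpos := hsol.density_pos hρ₀_int hρ₀_pos
  have hρ' := hpos k hk.le
  have hρ := hpos (k + 1) hk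
  have hu := hsol.velocity_mem k hk
  obtain ⟨ξ, ζ, hξ, hζ, hint⟩ :=
    MHD.Triangulation.internal_balance hd0 hu (hsol.continuity k hk) hρ' hρ
  have hkin := MHD.Triangulation.kinetic_balance hu (hsol.continuity k hk) (hsol.momentum k hk)
  have hmag := MHD.Triangulation.magnetic_balance (hsol.magnetic_mem k hk) (hsol.maxwell k hk)
  have hbal : P.Dt (T.energy P (ρ k) (u k) (B k))
        (T.energy P (ρ (k + 1)) (u (k + 1)) (B (k + 1)))
      + T.physicalDissipation P (u (k + 1)) (B (k + 1))
      = - T.timeDissVelocity P (ρ k) (u k) (u (k + 1))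
        - T.timeDissMagnetic P (B k) (B (k + 1))
        - T.timeDissDensity P ξ (ρ k) (ρ (k + 1))
        - T.jumpDissVelocity O P (ρ (k + 1)) (u (k + 1))
        - T.jumpDissDensity O P ζ (ρ (k + 1)) (u (k + 1)) := by
    rw [MHD.Triangulation.energy_eq, MHD.Triangulation.energy_eq,
      MHD.Triangulation.physicalDissipation, MHD.Params.Dt, smul_eq_mul]
    -- Pressure work and Lorentz work each occur twice with opposite signs and drop out of the sum.
    linear_combination hint + hkin + hmag
  have s1 := MHD.Triangulation.timeDissVelocity_nonneg P hρ' (u k) (u (k + 1))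
  have s2 := MHD.Triangulation.timeDissMagnetic_nonneg P (B k) (B (k + 1))
  have s3 := MHD.Triangulation.timeDissDensity_nonneg P
    (fun K => MHD.Params.pos_of_mem_uIcc (hρ' K) (hρ K) (hξ K)) (ρ k) (ρ (k + 1))
  have s4 := MHD.Triangulation.jumpDissVelocity_nonneg O P hρ (u (k + 1))
  have s5 := MHD.Triangulation.jumpDissDensity_nonneg O P
    (fun σ => MHD.Params.pos_of_mem_uIcc (hρ (O.inn σ)) (hρ (O.out σ)) (hζ σ))
    (ρ (k + 1)) (u (k + 1))
  have s6 := MHD.Triangulation.physicalDissipation_nonneg hd2 P (u (k + 1)) (B (k + 1))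
  refine ⟨ξ, ζ, hξ, fun σ _ => hζ σ, hbal, s1, s2, s3, s4, s5, by linarith, ?_⟩
  have hDt : P.dt⁻¹ * (T.energy P (ρ (k + 1)) (u (k + 1)) (B (k + 1))
      - T.energy P (ρ k) (u k) (B k)) ≤ 0 := by
    rw [MHD.Params.Dt, smul_eq_mul] at hbal
    linarith
  exact sub_nonpos.1 (nonpos_of_mul_nonpos_right hDt (inv_pos.2 P.dt_pos))
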